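/- Let $m>3$ and let $\mathbf R$ be a real matrix with $m$ rows and $3$ columns such that $\mathbf R^Tk\neq 0$ for all $k\in\mathbb Z^m\setminus\{0\}$. Let $\Omega\subset\mathbb R^3$ be a bounded open set with Lipschitz boundary and $Y^m=\,]0,1[^m$; the index $\sharp$ denotes $Y^m$-periodicity. Given positive numbers $\eta_k\to0$ and functions $u_k\in L^2(\Omega)$, we say that $u_k$ two-scale converges weakly to $u_0\in L^2(\Omega\times Y^m)$ if $$\lim_{k\to\infty}\int_\Omega u_k(x)\,\varphi\Bigl(x,\frac{\mathbf Rx}{\eta_k}\Bigr)\,dx=\int_\Omega\int_{Y^m}u_0(x,y)\,\varphi(x,y)\,dy\,dx\qquad\text{for all }\varphi\in L^2(\Omega;C_\sharp(Y^m)),$$ and that it two-scale converges strongly to $u_0$ if moreover $\|u_k\|_{L^2(\Omega)}\to\|u_0\|_{L^2(\Omega\times Y^m)}$; for vector fields, weak two-scale convergence is understood componentwise. A field $w\in L^2_\sharp(Y^m;\mathbb R^3)$ is the $\mathbf R$-gradient $\mathrm{grad}_{\mathbf R}\phi=(\mathbf R^T\nabla_y)\phi$ of a real scalar potential $\phi$,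 given by its formal Fourier series $\sum_{k\in\mathbb Z^m}\phi_k e^{2\pi i k\cdot y}$ ($\phi_{-k}=\overline{\phi_k}$, not necessarily square summable), if the Fourier coefficients of $w$ are $w_k=2\pi i\,\phi_k\,\mathbf R^Tk$ for all $k\in\mathbb Z^m$. Let $\eta_n>0$, $\eta_n\to0$, and let $(u_{\eta_n})$ be a bounded sequence in $W^{1,2}(\Omega)$. Then there exist a subsequence $\eta_{n_k}$, a function $u\in W^{1,2}(\Omega)$, and a family of potentials $u_1(x,\cdot)$, $x\in\Omega$, whose Fourier coefficients are measurable in $x$, with $\mathrm{grad}_{\mathbf R}u_1\in L^2(\Omega;L^2_\sharp(Y^m;\mathbb R^3))$, such that, as $k\to\infty$, $$u_{\eta_{n_k}}\to u(x)\quad\text{two-scale strongly},\qquad \nabla u_{\eta_{n_k}}\rightharpoonup\nabla u(x)+\mathrm{grad}_{\mathbf R}u_1(x,y)\quad\text{two-scale weakly}.$$ -/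

import Mathlib

open MeasureTheory Filter Topology
open scoped ENNReal NNReal ContDiff Matrix

noncomputable section

namespace CutProjection

/-- The physical space `ℝ³` with its Euclidean norm. -/
abbrev E3 : Type := EuclideanSpace ℝ (Fin 3)

/-- The torus `ℝ^m / ℤ^m`; functions on it are the `Y^m`-periodic functions on `ℝ^m`, where
`Y^m = ]0,1[^m`. -/
abbrev Torus (m : ℕ) : Type := UnitAddTorus (Fin m)

/-- Lebesgue measure on the cell `Y^m`, seen on the torus: the product of the Haar probability
measures on the circles. -/
def torusMeasure (m : ℕ) : Measure (Torus m) :=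
  Measure.pi fun _ => AddCircle.haarAddCircle

/-- `Ω` has a Lipschitz boundary: near each boundary point, in suitable orthonormal coordinates,
`Ω` is the part of a ball lying strictly above the graph of a Lipschitz function. -/
def HasLipschitzBoundary (Ω : Set E3) : Prop :=
  ∀ p ∈ frontier Ω, ∃ r : ℝ, 0 < r ∧
    ∃ (e : E3 ≃ₗᵢ[ℝ] E3) (γ : EuclideanSpace ℝ (Fin 2) → ℝ) (K : ℝ≥0),
      LipschitzWith K γ ∧
      Ω ∩ Metric.ball p r = {x ∈ Metric.ball p r | γ !₂[e x 0, e x 1] < e x 2}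

/-- `g` is the weak gradient of `u` on `Ω` (tested against smooth functions compactly supported
in `Ω`). -/
def HasWeakGradient (Ω : Set E3) (u : E3 → ℝ) (g : E3 → E3) : Prop :=
  ∀ φ : E3 → ℝ, ContDiff ℝ ∞ φ → HasCompactSupport φ → tsupport φ ⊆ Ω → ∀ i : Fin 3,
    ∫ x in Ω, u x * fderiv ℝ φ x (EuclideanSpace.single i 1) = - ∫ x in Ω, g x i * φ x

/-- `u ∈ W^{1,2}(Ω)` with `grad u = g`: both are square integrable on `Ω` and `g` is the weak
gradient of `u`. -/
structure IsW12 (Ω : Set E3) (u : E3 → ℝ) (g : E3 → E3) : Prop where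
  memLp : MemLp u 2 (volume.restrict Ω)
  memLp_grad : MemLp g 2 (volume.restrict Ω)
  weakGradient : HasWeakGradient Ω u g

/-- The `W^{1,2}(Ω)` norm of a function `u` with weak gradient `g`. -/
def w12Norm (Ω : Set E3) (u : E3 → ℝ) (g : E3 → E3) : ℝ≥0∞ :=
  (eLpNorm u 2 (volume.restrict Ω) ^ 2 + eLpNorm g 2 (volume.restrict Ω) ^ 2) ^ (1 / 2 : ℝ)

variable {m : ℕ}

/-- The irrationality criterion `Rᵀ k ≠ 0` for all nonzero integer vectors `k`. -/
def IsIrrational (R : Matrix (Fin m) (Fin 3) ℝ) : Prop :=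
  ∀ k : Fin m → ℤ, k ≠ 0 → Rᵀ *ᵥ (fun j => (k j : ℝ)) ≠ 0

/-- The fast variable: the class of `R x / η` modulo `ℤ^m`. -/
def fastPoint (R : Matrix (Fin m) (Fin 3) ℝ) (η : ℝ) (x : E3) : Torus m :=
  fun j => (((R *ᵥ x.ofLp) j / η : ℝ) : UnitAddCircle)

/-- Weak two-scale cut-and-projection convergence, for the matrix `R` and along the scales `η k`,
of the sequence `u k` in `L²(Ω)` to `u₀ ∈ L²(Ω × Y^m)`. The test functions are all elements of
`L²(Ω; C_♯(Y^m))`. -/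
structure WeakTwoScale (R : Matrix (Fin m) (Fin 3) ℝ) (Ω : Set E3) (η : ℕ → ℝ)
    (u : ℕ → E3 → ℝ) (u₀ : E3 → Torus m → ℝ) : Prop where
  memLp : ∀ k, MemLp (u k) 2 (volume.restrict Ω)
  memLp_limit :
    MemLp (fun p : E3 × Torus m => u₀ p.1 p.2) 2 ((volume.restrict Ω).prod (torusMeasure m))
  tendsto : ∀ φ : E3 → C(Torus m, ℝ), MemLp φ 2 (volume.restrict Ω) →
    Tendsto (fun k => ∫ x in Ω, u k x * φ x (fastPoint R (η k) x)) atTop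
      (𝓝 (∫ p : E3 × Torus m, u₀ p.1 p.2 * φ p.1 p.2
        ∂((volume.restrict Ω).prod (torusMeasure m))))

/-- Strong two-scale cut-and-projection convergence: weak two-scale convergence together with
convergence of the `L²` norms. -/
structure StrongTwoScale (R : Matrix (Fin m) (Fin 3) ℝ) (Ω : Set E3) (η : ℕ → ℝ)
    (u : ℕ → E3 → ℝ) (u₀ : E3 → Torus m → ℝ) : Prop where
  weak : WeakTwoScale R Ω η u u₀
  norm_tendsto :
    Tendsto (fun k => eLpNorm (u k) 2 (volume.restrict Ω)) atTop
      (𝓝 (eLpNorm (fun p : E3 × Torus m => u₀ p.1 p.2) 2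
        ((volume.restrict Ω).prod (torusMeasure m))))

/-- Weak two-scale convergence of vector fields, componentwise. -/
def WeakTwoScaleVec (R : Matrix (Fin m) (Fin 3) ℝ) (Ω : Set E3) (η : ℕ → ℝ)
    (v : ℕ → E3 → E3) (v₀ : E3 → Torus m → E3) : Prop :=
  ∀ i : Fin 3, WeakTwoScale R Ω η (fun k x => v k x i) (fun x y => v₀ x y i)

/-- A real scalar potential on `Y^m`, given by its formal Fourier series
`∑ₖ c k • exp (2πi k·y)`. No growth condition is imposed on the coefficients (only the
`R`-gradient of the potential has to be square integrable); the symmetry says that the potential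
is real. -/
structure Potential (m : ℕ) where
  coeff : (Fin m → ℤ) → ℂ
  coeff_neg : ∀ k, coeff (-k) = starRingEnd ℂ (coeff k)

/-- The Fourier coefficients of `grad_R φ = (Rᵀ ∇_y) φ` : the `k`-th one is `2πi (Rᵀ k) φ_k`. -/
def gradRCoeff (R : Matrix (Fin m) (Fin 3) ℝ) (φ : Potential m) (k : Fin m → ℤ) (i : Fin 3) : ℂ :=
  2 * Real.pi * Complex.I * (((Rᵀ *ᵥ (fun j => (k j : ℝ))) i : ℝ) : ℂ) * φ.coeff k

/-- `w` is a square integrable periodic vector field and `w = grad_R φ`, i.e. the Fourier series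
of `w` is the one of `grad_R φ`. -/
structure IsGradR (R : Matrix (Fin m) (Fin 3) ℝ) (φ : Potential m) (w : Torus m → E3) : Prop where
  memLp : MemLp w 2 (torusMeasure m)
  fourier : ∀ (k : Fin m → ℤ) (i : Fin 3),
    UnitAddTorus.mFourierCoeff (fun y => ((w y i : ℝ) : ℂ)) k = gradRCoeff R φ k i

/-- The symbol in `gradRCoeff` is that of `Rᵀ ∇_y`: for `y = R x`, the derivative of
`exp (2πi k·y)` along the `i`-th coordinate direction of `ℝ³` multiplies it by `2πi (Rᵀ k)_i`. -/
theorem hasDerivAt_mFourier (R : Matrix (Fin m) (Fin 3) ℝ) (k : Fin m → ℤ) (i : Fin 3)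
    (y : Fin m → ℝ) :
    HasDerivAt (fun t : ℝ =>
        UnitAddTorus.mFourier k (fun j => ((y j + t * R j i : ℝ) : UnitAddCircle)))
      (2 * Real.pi * Complex.I * (((Rᵀ *ᵥ (fun j => (k j : ℝ))) i : ℝ) : ℂ) *
        UnitAddTorus.mFourier k (fun j => ((y j : ℝ) : UnitAddCircle))) 0 := by
  have h : ∀ z : Fin m → ℝ, UnitAddTorus.mFourier k (fun j => ((z j : ℝ) : UnitAddCircle)) =
      Complex.exp (2 * Real.pi * Complex.I * ∑ j, (k j : ℂ) * (z j : ℂ)) := by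
    intro z
    simp only [UnitAddTorus.mFourier, ContinuousMap.coe_mk, fourier_coe_apply, Finset.mul_sum,
      Complex.exp_sum]
    refine Finset.prod_congr rfl fun j _ => ?_
    congr 1
    push_cast
    ring
  simp only [h]
  have h1 : HasDerivAt (fun t : ℝ => 2 * Real.pi * Complex.I *
      ∑ j, (k j : ℂ) * ((y j + t * R j i : ℝ) : ℂ))
      (2 * Real.pi * Complex.I * ∑ j, (k j : ℂ) * ((R j i : ℝ) : ℂ)) 0 := by
    refine HasDerivAt.const_mul _ (HasDerivAt.fun_sum fun j _ => HasDerivAt.const_mul _ ?_)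
    have := (((hasDerivAt_id (0 : ℝ)).mul_const (R j i)).const_add (y j)).ofReal_comp
    simpa using this
  convert h1.cexp using 1
  simp only [Matrix.mulVec, dotProduct, Matrix.transpose_apply]
  push_cast
  simp only [zero_mul, add_zero]
  rw [mul_comm]
  congr 2
  exact Finset.sum_congr rfl fun j _ => mul_comm _ _

end CutProjection

end

/-!
Two compactness facts and one choice of test functions give the theorem.

*Two-scale compactness.* As `R` is irrational, `Rᵀ k / η → ∞` for every `k ≠ 0`, so by the
Riemann–Lebesgue lemma and density of trigonometric polynomials the functions `ψ(x, R x / η)`,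
`ψ ∈ L¹(Ω; C_♯(Y^m))`, converge in mean to the cell average of `ψ` (`tendsto_integral_eval`). The
functionals `φ ↦ ∫ u_n(x) φ(x, R x / η_n) dx` are bounded on the separable space
`L²(Ω; C_♯(Y^m))`, so along a subsequence they converge pointwise (sequential Banach–Alaoglu). The
mean value property applied to `φ²` bounds the limit functional by the norm of `L²(Ω × Y^m)`, and
Riesz representation yields the two-scale limit (`exists_weakTwoScale_subseq`). This is applied to
`u_n` and to the components of `∇ u_n`; the cell averages of the limits are the weak limits, hence
a function `v ∈ W^{1,2}(Ω)` and its gradient (`isW12_average`).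

*Rellich–Kondrachov.* Strong two-scale convergence of `u_n` follows from `u_n → v` in `L²(Ω)`. Near
each point of `closure Ω` there is an open set of arbitrarily short vectors `h` that push `Ω` into
itself (`exists_hasInwardTranslations`); at the boundary these are the nearly vertical ones. For
these, `‖f(· + h) - f‖ ≤ ‖h‖ ‖∇f‖` locally (`toReal_eLpNorm_translate_sub_le`, by duality with test
functions). So `f_n = u_n - v` is uniformly close to its average over such `h`; at each point that
average is the pairing of `f_n` with a fixed `L²` function, so weak convergence of `f_n` and
dominated convergence make the averages converge strongly (`tendsto_eLpNorm_of_weak`).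

*The oscillating part.* Let `b = Rᵀ k ≠ 0` and `h ⊥ b`. The derivative in the direction `h` of
`ψ(x) exp (2πi k·R x / η)` does not hit the exponential, so integrating `∇ u_n` by parts against it
leaves `∫ u_n(x) ∂_h ψ(x) exp (2πi k·R x / η) dx`, whose limit vanishes, since the two-scale limit
`v` of `u_n` does not depend on `y` and the exponential has zero mean. Hence the `k`-th
Fourier coefficient of the two-scale limit of `∇ u_n` is orthogonal to every `h ⊥ b`
(`ae_moment_eq_zero`), i.e. parallel to `Rᵀ k`
(`ae_freq_mul_comm`). Dividing by the symbol gives the potential (`gradPotential`).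
-/

namespace CutProjection

/-! ### The mean value property of oscillating functions -/

instance (m : ℕ) : IsProbabilityMeasure (torusMeasure m) := by
  unfold torusMeasure; infer_instance

variable {m : ℕ}

/-- The frequency vector `Rᵀ k ∈ ℝ³` of the oscillation `x ↦ exp (2πi k·R x)`. -/
noncomputable def freq (R : Matrix (Fin m) (Fin 3) ℝ) (k : Fin m → ℤ) : E3 :=
  WithLp.toLp 2 (Rᵀ *ᵥ fun j => (k j : ℝ))

theorem freq_zero (R : Matrix (Fin m) (Fin 3) ℝ) : freq R 0 = 0 := by
  ext i
  simp [freq, Matrix.mulVec, dotProduct]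

theorem freq_neg (R : Matrix (Fin m) (Fin 3) ℝ) (k : Fin m → ℤ) : freq R (-k) = -freq R k := by
  ext i
  simp [freq, Matrix.mulVec, dotProduct]

theorem freq_ne_zero {R : Matrix (Fin m) (Fin 3) ℝ} (hR : IsIrrational R) {k : Fin m → ℤ}
    (hk : k ≠ 0) : freq R k ≠ 0 := by
  intro h
  refine hR k hk ?_
  have := congrArg WithLp.ofLp h
  simpa [freq] using this

theorem continuous_fastPoint (R : Matrix (Fin m) (Fin 3) ℝ) (η : ℝ) :
    Continuous (fastPoint R η) := by
  unfold fastPoint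
  refine continuous_pi fun j => ?_
  refine (AddCircle.continuous_mk' 1).comp ?_
  simp only [Matrix.mulVec, dotProduct]
  fun_prop

theorem mFourier_fastPoint (R : Matrix (Fin m) (Fin 3) ℝ) (η : ℝ) (k : Fin m → ℤ) (x : E3) :
    UnitAddTorus.mFourier k (fastPoint R η x) =
      Complex.exp ((2 * Real.pi * (η⁻¹ * inner ℝ x (freq R k)) : ℝ) * Complex.I) := by
  have h : inner ℝ x (freq R k) = ∑ j, (k j : ℝ) * (R *ᵥ x.ofLp) j := by
    simp only [freq, PiLp.inner_apply, Matrix.mulVec, dotProduct, Matrix.transpose_apply,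
      RCLike.inner_apply, conj_trivial, Finset.mul_sum, Finset.sum_mul]
    rw [Finset.sum_comm]
    exact Finset.sum_congr rfl fun j _ => Finset.sum_congr rfl fun i _ => by ring
  rw [h]
  simp only [UnitAddTorus.mFourier, ContinuousMap.coe_mk, fastPoint, fourier_coe_apply]
  rw [← Complex.exp_sum]
  congr 1
  push_cast
  simp only [Finset.mul_sum, Finset.sum_mul]
  exact Finset.sum_congr rfl fun j _ => by ring

theorem integral_mFourier (k : Fin m → ℤ) :
    ∫ y, UnitAddTorus.mFourier k y ∂(torusMeasure m) = if k = 0 then 1 else 0 := by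
  have h := orthonormal_iff_ite.mp (UnitAddTorus.orthonormal_mFourier (d := Fin m)) 0 k
  rw [ContinuousMap.inner_toLp] at h
  simp only [UnitAddTorus.mFourier_zero, ContinuousMap.one_apply, map_one, mul_one] at h
  simpa only [eq_comm (a := (0 : Fin m → ℤ))] using! h

/-- A sequence that can be approximated, uniformly and together with its candidate limit, by
convergent sequences converges to that limit. -/
theorem tendsto_of_forall_approx {F : Type*} [SeminormedAddCommGroup F] {a : ℕ → F} {l : F}
    (h : ∀ ε > 0, ∃ (b : ℕ → F) (l' : F), Tendsto b atTop (𝓝 l') ∧ (∀ n, ‖a n - b n‖ ≤ ε) ∧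
      ‖l - l'‖ ≤ ε) : Tendsto a atTop (𝓝 l) := by
  rw [Metric.tendsto_atTop]
  intro ε hε
  obtain ⟨b, l', hb, hab, hl⟩ := h (ε / 4) (by positivity)
  obtain ⟨N, hN⟩ := Metric.tendsto_atTop.mp hb (ε / 4) (by positivity)
  refine ⟨N, fun n hn => ?_⟩
  have h1 := hN n hn
  have h2 := hab n
  rw [← dist_eq_norm] at h2 hl
  calc dist (a n) l ≤ dist (a n) (b n) + dist (b n) l' + dist l' l := dist_triangle4 _ _ _ _
    _ < ε := by rw [dist_comm l' l]; linarith

/-- For `k ≠ 0` the irrationality of `R` makes `Rᵀ k / η n` tend to infinity, so that the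
Riemann–Lebesgue lemma applies. -/
theorem tendsto_setIntegral_mFourier {R : Matrix (Fin m) (Fin 3) ℝ} (hR : IsIrrational R)
    {η : ℕ → ℝ} (hη_pos : ∀ n, 0 < η n) (hη : Tendsto η atTop (𝓝 0)) {A : Set E3}
    (hA : MeasurableSet A) (k : Fin m → ℤ) :
    Tendsto (fun n => ∫ x in A, UnitAddTorus.mFourier k (fastPoint R (η n) x)) atTop
      (𝓝 (∫ _ in A, ∫ y, UnitAddTorus.mFourier k y ∂(torusMeasure m))) := by
  rw [integral_mFourier]
  split_ifs with hk
  · simp only [hk, UnitAddTorus.mFourier_zero, ContinuousMap.one_apply]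
    exact tendsto_const_nhds
  · have h := tendsto_integral_exp_inner_smul_cocompact
      (V := E3) (A.indicator (fun _ => (1 : ℂ)))
    have h2 : Tendsto (fun n => (-(η n)⁻¹) • freq R k) atTop (cocompact E3) := by
      rw [← Metric.cobounded_eq_cocompact, ← tendsto_norm_atTop_iff_cobounded]
      simp only [norm_smul, norm_neg, norm_inv]
      refine Tendsto.atTop_mul_const (norm_pos_iff.mpr (freq_ne_zero hR hk)) ?_
      have : Tendsto (fun n => (η n)⁻¹) atTop atTop :=
        Tendsto.inv_tendsto_nhdsGT_zero (tendsto_nhdsWithin_iff.mpr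
          ⟨hη, Eventually.of_forall fun n => hη_pos n⟩)
      refine this.congr fun n => ?_
      rw [Real.norm_of_nonneg (hη_pos n).le]
    simp only [integral_zero]
    refine (h.comp h2).congr fun n => ?_
    rw [← integral_indicator hA]
    refine integral_congr_ae (Eventually.of_forall fun x => ?_)
    by_cases hx : x ∈ A
    · simp only [hx, Set.indicator_of_mem, mFourier_fastPoint, Circle.smul_def,
        Real.fourierChar_apply, inner_smul_right]
      simp
    · simp [hx]

/-- The values of a continuous function along `x ↦ R x / η n` converge weakly to its mean: by
density of the trigonometric polynomials this reduces to the Riemann–Lebesgue lemma. -/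
theorem tendsto_setIntegral_complex {R : Matrix (Fin m) (Fin 3) ℝ} (hR : IsIrrational R)
    {η : ℕ → ℝ} (hη_pos : ∀ n, 0 < η n) (hη : Tendsto η atTop (𝓝 0)) {A : Set E3}
    (hA : MeasurableSet A) (hAfin : volume A < ⊤) (c : C(Torus m, ℂ)) :
    Tendsto (fun n => ∫ x in A, c (fastPoint R (η n) x)) atTop
      (𝓝 (∫ _ in A, ∫ y, c y ∂(torusMeasure m))) := by
  have : IsFiniteMeasure (volume.restrict A) := ⟨by simpa using hAfin⟩
  have hint : ∀ (c : C(Torus m, ℂ)) n,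
      Integrable (fun x => c (fastPoint R (η n) x)) (volume.restrict A) := fun c n =>
    Integrable.of_bound (c.continuous.comp (continuous_fastPoint R _)).aestronglyMeasurable
      ‖c‖ (Eventually.of_forall fun x => c.norm_coe_le_norm _)
  have hintT : ∀ c : C(Torus m, ℂ), Integrable (fun y => c y) (torusMeasure m) := fun c =>
    Integrable.of_bound c.continuous.aestronglyMeasurable
      ‖c‖ (Eventually.of_forall fun x => c.norm_coe_le_norm _)
  have key : ∀ c ∈ Submodule.span ℂ (Set.range (UnitAddTorus.mFourier (d := Fin m))),
      Tendsto (fun n => ∫ x in A, c (fastPoint R (η n) x)) atTop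
        (𝓝 (∫ _ in A, ∫ y, c y ∂(torusMeasure m))) := by
    intro c hc
    induction hc using Submodule.span_induction with
    | mem c h =>
      obtain ⟨k, rfl⟩ := h
      exact tendsto_setIntegral_mFourier hR hη_pos hη hA k
    | zero => simp
    | add c d _ _ hc hd =>
      simp only [ContinuousMap.add_apply]
      rw [integral_add (hintT c) (hintT d), integral_add (integrable_const _) (integrable_const _)]
      refine (hc.add hd).congr fun n => ?_
      rw [integral_add (hint c n) (hint d n)]
    | smul a c _ hc =>
      simp only [ContinuousMap.smul_apply, integral_smul]
      exact hc.const_smul a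
  refine tendsto_of_forall_approx fun ε hε => ?_
  set M := (volume.restrict A).real Set.univ with hM
  have hM0 : 0 ≤ M := measureReal_nonneg
  have hc : c ∈ closure (Submodule.span ℂ (Set.range (UnitAddTorus.mFourier (d := Fin m))) :
      Set C(Torus m, ℂ)) := by
    rw [← Submodule.topologicalClosure_coe, UnitAddTorus.span_mFourier_closure_eq_top]
    trivial
  obtain ⟨d, hd, hcd⟩ := Metric.mem_closure_iff.mp hc (ε / (M + 1)) (by positivity)
  have hcd' : ∀ y, ‖c y - d y‖ ≤ ε / (M + 1) := fun y => by
    rw [← dist_eq_norm]; exact (ContinuousMap.dist_apply_le_dist y).trans hcd.le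
  have hMε : ε / (M + 1) * M ≤ ε := by
    rw [div_mul_eq_mul_div, div_le_iff₀ (by positivity)]; nlinarith
  refine ⟨_, _, key d hd, fun n => ?_, ?_⟩
  · rw [← integral_sub (hint c n) (hint d n)]
    exact (norm_integral_le_of_norm_le_const (Eventually.of_forall fun x => hcd' _)).trans hMε
  · rw [← integral_sub (integrable_const _) (integrable_const _)]
    refine (norm_integral_le_of_norm_le_const (C := ε / (M + 1))
      (Eventually.of_forall fun x => ?_)).trans hMε
    rw [← integral_sub (hintT c) (hintT d)]
    refine (norm_integral_le_of_norm_le_const (Eventually.of_forall fun y => hcd' y)).trans ?_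
    simp

theorem tendsto_setIntegral_real {R : Matrix (Fin m) (Fin 3) ℝ} (hR : IsIrrational R)
    {η : ℕ → ℝ} (hη_pos : ∀ n, 0 < η n) (hη : Tendsto η atTop (𝓝 0)) {A : Set E3}
    (hA : MeasurableSet A) (hAfin : volume A < ⊤) (c : C(Torus m, ℝ)) :
    Tendsto (fun n => ∫ x in A, c (fastPoint R (η n) x)) atTop
      (𝓝 (∫ _ in A, ∫ y, c y ∂(torusMeasure m))) := by
  have h := tendsto_setIntegral_complex hR hη_pos hη hA hAfin
    ⟨fun y => (c y : ℂ), Complex.continuous_ofReal.comp c.continuous⟩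
  simp only [ContinuousMap.coe_mk, integral_complex_ofReal] at h
  have h2 := (Complex.continuous_re.tendsto _).comp h
  simpa only [Function.comp_def, Complex.ofReal_re] using h2

theorem aestronglyMeasurable_eval {μ : Measure E3} {ψ : E3 → C(Torus m, ℝ)}
    (hψ : AEStronglyMeasurable ψ μ) {g : E3 → Torus m} (hg : Continuous g) :
    AEStronglyMeasurable (fun x => ψ x (g x)) μ :=
  continuous_eval.comp_aestronglyMeasurable (hψ.prodMk hg.aestronglyMeasurable)

theorem aestronglyMeasurable_uncurry {μ : Measure E3} [SFinite μ] {ψ : E3 → C(Torus m, ℝ)}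
    (hψ : AEStronglyMeasurable ψ μ) :
    AEStronglyMeasurable (fun p : E3 × Torus m => ψ p.1 p.2) (μ.prod (torusMeasure m)) :=
  continuous_eval.comp_aestronglyMeasurable
    (hψ.comp_fst.prodMk measurable_snd.aestronglyMeasurable)

theorem integrable_eval {μ : Measure E3} {ψ : E3 → C(Torus m, ℝ)}
    (hψ : Integrable ψ μ) {g : E3 → Torus m} (hg : Continuous g) :
    Integrable (fun x => ψ x (g x)) μ :=
  hψ.norm.mono' (aestronglyMeasurable_eval hψ.1 hg)
    (Eventually.of_forall fun x => (ψ x).norm_coe_le_norm _)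

theorem integrable_uncurry {μ : Measure E3} [SFinite μ] {ψ : E3 → C(Torus m, ℝ)}
    (hψ : Integrable ψ μ) :
    Integrable (fun p : E3 × Torus m => ψ p.1 p.2) (μ.prod (torusMeasure m)) :=
  (hψ.norm.comp_fst (torusMeasure m)).mono' (aestronglyMeasurable_uncurry hψ.1)
    (Eventually.of_forall fun p => (ψ p.1).norm_coe_le_norm _)

theorem norm_integral_eval_le {μ : Measure E3} {ψ : E3 → C(Torus m, ℝ)}
    (hψ : Integrable ψ μ) (g : E3 → Torus m) :
    ‖∫ x, ψ x (g x) ∂μ‖ ≤ ∫ x, ‖ψ x‖ ∂μ :=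
  norm_integral_le_of_norm_le hψ.norm (Eventually.of_forall fun x => (ψ x).norm_coe_le_norm _)

theorem norm_integral_uncurry_le {μ : Measure E3} [SFinite μ] {ψ : E3 → C(Torus m, ℝ)}
    (hψ : Integrable ψ μ) :
    ‖∫ p, ψ p.1 p.2 ∂(μ.prod (torusMeasure m))‖ ≤ ∫ x, ‖ψ x‖ ∂μ := by
  refine (norm_integral_le_of_norm_le (hψ.norm.comp_fst (torusMeasure m))
    (Eventually.of_forall fun p => (ψ p.1).norm_coe_le_norm _)).trans_eq ?_
  have := integral_fun_fst (μ := μ) (ν := torusMeasure m) (fun x => ‖ψ x‖)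
  simpa using this

/-- The mean value property of oscillating functions `x ↦ ψ (x, R x / η)`, `ψ ∈ L¹(Ω; C_♯(Y^m))`:
they converge in mean to the average of `ψ` over the cell. -/
theorem tendsto_integral_eval {R : Matrix (Fin m) (Fin 3) ℝ} (hR : IsIrrational R)
    {η : ℕ → ℝ} (hη_pos : ∀ n, 0 < η n) (hη : Tendsto η atTop (𝓝 0)) {Ω : Set E3}
    (hΩfin : volume Ω < ⊤) {ψ : E3 → C(Torus m, ℝ)}
    (hψ : Integrable ψ (volume.restrict Ω)) :
    Tendsto (fun n => ∫ x in Ω, ψ x (fastPoint R (η n) x)) atTop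
      (𝓝 (∫ p, ψ p.1 p.2 ∂((volume.restrict Ω).prod (torusMeasure m)))) := by
  have : IsFiniteMeasure (volume.restrict Ω) := ⟨by simpa using hΩfin⟩
  refine Integrable.induction (P := fun ψ : E3 → C(Torus m, ℝ) =>
    Tendsto (fun n => ∫ x in Ω, ψ x (fastPoint R (η n) x)) atTop
      (𝓝 (∫ p, ψ p.1 p.2 ∂((volume.restrict Ω).prod (torusMeasure m))))) ?_ ?_ ?_ ?_ hψ
  · intro c A hA hAfin
    have hind : ∀ (x : E3) (y : Torus m),
        (A.indicator (fun _ => c) x) y = A.indicator (fun _ => c y) x := by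
      intro x y
      by_cases hx : x ∈ A <;> simp [hx]
    have hi : Integrable (A.indicator fun _ => c) (volume.restrict Ω) :=
      (integrable_const c).indicator hA
    rw [integral_prod _ (integrable_uncurry hi)]
    -- `Ω` need not be measurable here; `volume.restrict Ω` is also the restriction to its
    -- measurable hull.
    have h := tendsto_setIntegral_real hR hη_pos hη (A := A ∩ toMeasurable volume Ω)
      (hA.inter (measurableSet_toMeasurable _ _))
      (lt_of_le_of_lt (measure_mono Set.inter_subset_right) (by rwa [measure_toMeasurable])) c
    rw [← Measure.restrict_restrict hA, Measure.restrict_toMeasurable hΩfin.ne,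
      ← integral_indicator hA] at h
    have e1 : (fun x : E3 => A.indicator (fun _ => ∫ y, c y ∂(torusMeasure m)) x) =
        fun x => ∫ y, (A.indicator (fun _ => c) x) y ∂(torusMeasure m) := by
      funext x
      by_cases hx : x ∈ A <;> simp [hx]
    rw [e1] at h
    refine h.congr fun n => ?_
    rw [← integral_indicator hA]
    refine integral_congr_ae (Eventually.of_forall fun x => ?_)
    by_cases hx : x ∈ A <;> simp [hx]
  · intro f g _ hf hg hPf hPg
    simp only [Pi.add_apply, ContinuousMap.add_apply]
    rw [integral_add (integrable_uncurry hf) (integrable_uncurry hg)]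
    refine (hPf.add hPg).congr fun n => ?_
    rw [integral_add (integrable_eval hf (continuous_fastPoint _ _))
      (integrable_eval hg (continuous_fastPoint _ _))]
  -- Both sides are dominated by the `L¹` norm, uniformly in `n`, so convergence is a closed
  -- condition.
  · rw [← closure_subset_iff_isClosed]
    intro f hf
    refine tendsto_of_forall_approx fun ε hε => ?_
    obtain ⟨g, hg, hfg⟩ := Metric.mem_closure_iff.mp hf ε hε
    have hsub : Integrable (fun x => f x - g x) (volume.restrict Ω) :=
      (L1.integrable_coeFn f).sub (L1.integrable_coeFn g)
    have hle : ∫ x in Ω, ‖f x - g x‖ ≤ ε := by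
      rw [L1.dist_def] at hfg
      refine le_trans (le_of_eq ?_) hfg.le
      rw [integral_norm_eq_lintegral_enorm hsub.1]
      simp only [edist_eq_enorm_sub]
    refine ⟨_, _, hg, fun n => ?_, ?_⟩
    · rw [← integral_sub (integrable_eval (L1.integrable_coeFn f) (continuous_fastPoint _ _))
        (integrable_eval (L1.integrable_coeFn g) (continuous_fastPoint _ _))]
      exact (norm_integral_eval_le hsub (fastPoint R (η n))).trans hle
    · rw [← integral_sub (integrable_uncurry (L1.integrable_coeFn f))
        (integrable_uncurry (L1.integrable_coeFn g))]
      exact (norm_integral_uncurry_le hsub).trans hle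
  · intro f g hfg hf hP
    have e : ∫ p, f p.1 p.2 ∂((volume.restrict Ω).prod (torusMeasure m)) =
        ∫ p, g p.1 p.2 ∂((volume.restrict Ω).prod (torusMeasure m)) := by
      refine integral_congr_ae ?_
      filter_upwards [Measure.quasiMeasurePreserving_fst.ae_eq_comp hfg] with p hp
      exact congrArg (fun c : C(Torus m, ℝ) => c p.2) hp
    rw [← e]
    refine hP.congr fun n => integral_congr_ae ?_
    filter_upwards [hfg] with x hx
    rw [hx]

/-! ### Weak two-scale compactness -/

theorem inner_toLp_eq_integral {α : Type*} [MeasurableSpace α] {μ : Measure α} {f g : α → ℝ}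
    (hf : MemLp f 2 μ) (hg : MemLp g 2 μ) :
    inner ℝ (hf.toLp f) (hg.toLp g) = ∫ x, f x * g x ∂μ := by
  rw [L2.inner_def]
  refine integral_congr_ae ?_
  filter_upwards [hf.coeFn_toLp, hg.coeFn_toLp] with x h1 h2
  rw [h1, h2]
  simp [mul_comm]

theorem integrable_mul_of_memLp_two {α : Type*} [MeasurableSpace α] {μ : Measure α} {f g : α → ℝ}
    (hf : MemLp f 2 μ) (hg : MemLp g 2 μ) : Integrable (fun x => f x * g x) μ :=
  hf.integrable_mul hg

/-- The Cauchy–Schwarz inequality for square integrable real functions. -/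
theorem abs_integral_mul_le {α : Type*} [MeasurableSpace α] {μ : Measure α} {f g : α → ℝ}
    (hf : MemLp f 2 μ) (hg : MemLp g 2 μ) :
    |∫ x, f x * g x ∂μ| ≤ (eLpNorm f 2 μ).toReal * (eLpNorm g 2 μ).toReal := by
  rw [← inner_toLp_eq_integral hf hg, ← Lp.norm_toLp f hf, ← Lp.norm_toLp g hg]
  exact abs_real_inner_le_norm _ _

theorem toReal_eLpNorm_two_sq {α : Type*} [MeasurableSpace α] {μ : Measure α} {f : α → ℝ}
    (hf : MemLp f 2 μ) : (eLpNorm f 2 μ).toReal ^ 2 = ∫ x, f x * f x ∂μ := by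
  rw [← inner_toLp_eq_integral hf hf, ← Lp.norm_toLp f hf, real_inner_self_eq_norm_sq]

theorem memLp_eval {μ : Measure E3} {ψ : E3 → C(Torus m, ℝ)}
    (hψ : MemLp ψ 2 μ) {g : E3 → Torus m} (hg : Continuous g) :
    MemLp (fun x => ψ x (g x)) 2 μ :=
  hψ.norm.mono' (aestronglyMeasurable_eval hψ.1 hg)
    (Eventually.of_forall fun x => (ψ x).norm_coe_le_norm _)

theorem memLp_uncurry {μ : Measure E3} [SFinite μ] {ψ : E3 → C(Torus m, ℝ)}
    (hψ : MemLp ψ 2 μ) :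
    MemLp (fun p : E3 × Torus m => ψ p.1 p.2) 2 (μ.prod (torusMeasure m)) :=
  (hψ.norm.comp_fst (torusMeasure m)).mono' (aestronglyMeasurable_uncurry hψ.1)
    (Eventually.of_forall fun p => (ψ p.1).norm_coe_le_norm _)

theorem integrable_sq_of_memLp {μ : Measure E3} {ψ : E3 → C(Torus m, ℝ)}
    (hψ : MemLp ψ 2 μ) : Integrable (fun x => ψ x * ψ x) μ := by
  refine (hψ.norm.integrable_sq).mono' (hψ.1.mul hψ.1) (Eventually.of_forall fun x => ?_)
  rw [sq]
  exact norm_mul_le _ _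

/-- **Riesz representation along a map.** A linear functional dominated by the norm of `ι`
with values in a Hilbert space is the inner product of `ι` with a fixed vector. -/
theorem exists_inner_eq_of_abs_le {V H : Type*} [AddCommGroup V] [Module ℝ V]
    [NormedAddCommGroup H] [InnerProductSpace ℝ H] [CompleteSpace H] (ι : V →ₗ[ℝ] H)
    (L : V →ₗ[ℝ] ℝ) (C : ℝ) (h : ∀ v, |L v| ≤ C * ‖ι v‖) :
    ∃ w : H, ∀ v, L v = inner ℝ w (ι v) := by
  have hker : LinearMap.ker ι ≤ LinearMap.ker L := by
    intro v hv
    rw [LinearMap.mem_ker] at hv ⊢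
    have := h v
    rw [hv, norm_zero, mul_zero] at this
    exact abs_nonpos_iff.mp this
  obtain ⟨s, hs⟩ := ι.rangeRestrict.exists_rightInverse_of_surjective ι.range_rangeRestrict
  have hL : ∀ v, L (s (ι.rangeRestrict v)) = L v := by
    intro v
    have h1 : ι.rangeRestrict (s (ι.rangeRestrict v)) = ι.rangeRestrict v :=
      LinearMap.congr_fun hs _
    have h2 : s (ι.rangeRestrict v) - v ∈ LinearMap.ker ι := by
      rw [LinearMap.mem_ker, map_sub, sub_eq_zero]
      simpa using congrArg Subtype.val h1
    have h3 := hker h2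
    rwa [LinearMap.mem_ker, map_sub, sub_eq_zero] at h3
  let f : StrongDual ℝ (LinearMap.range ι) := (L ∘ₗ s).mkContinuous C (by
    rintro ⟨_, v, rfl⟩
    have := h v
    rw [← hL v] at this
    simpa using! this)
  obtain ⟨g, hg, -⟩ := exists_extension_norm_eq _ f
  refine ⟨(InnerProductSpace.toDual ℝ H).symm g, fun v => ?_⟩
  rw [InnerProductSpace.toDual_symm_apply]
  exact (hL v).symm.trans (hg (ι.rangeRestrict v)).symm

/-- The pairing `φ ↦ ∫ u (x) φ (x, g (x)) dx` on `L²(Ω; C_♯(Y^m))`. -/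
noncomputable def pairing {μ : Measure E3} {u : E3 → ℝ} (hu : MemLp u 2 μ) {g : E3 → Torus m}
    (hg : Continuous g) : StrongDual ℝ (Lp C(Torus m, ℝ) 2 μ) :=
  LinearMap.mkContinuous
    { toFun := fun φ => ∫ x, u x * φ x (g x) ∂μ
      map_add' := fun φ ψ => by
        rw [← integral_add (integrable_mul_of_memLp_two hu (memLp_eval (Lp.memLp φ) hg))
          (integrable_mul_of_memLp_two hu (memLp_eval (Lp.memLp ψ) hg))]
        refine integral_congr_ae ?_
        filter_upwards [Lp.coeFn_add φ ψ] with x hx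
        rw [hx, Pi.add_apply, ContinuousMap.add_apply, mul_add]
      map_smul' := fun c φ => by
        rw [RingHom.id_apply, smul_eq_mul, ← integral_const_mul]
        refine integral_congr_ae ?_
        filter_upwards [Lp.coeFn_smul c φ] with x hx
        rw [hx, Pi.smul_apply, ContinuousMap.smul_apply, smul_eq_mul]
        ring } (eLpNorm u 2 μ).toReal fun φ => by
    refine (abs_integral_mul_le hu (memLp_eval (Lp.memLp φ) hg)).trans ?_
    refine mul_le_mul_of_nonneg_left ?_ ENNReal.toReal_nonneg
    rw [Lp.norm_def]
    refine ENNReal.toReal_mono (Lp.memLp φ).2.ne (eLpNorm_mono fun x => ?_)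
    exact (φ x).norm_coe_le_norm _

theorem pairing_apply {μ : Measure E3} {u : E3 → ℝ} (hu : MemLp u 2 μ) {g : E3 → Torus m}
    (hg : Continuous g) (φ : Lp C(Torus m, ℝ) 2 μ) :
    pairing hu hg φ = ∫ x, u x * φ x (g x) ∂μ := rfl

theorem norm_pairing_le {μ : Measure E3} {u : E3 → ℝ} (hu : MemLp u 2 μ) {g : E3 → Torus m}
    (hg : Continuous g) : ‖pairing hu hg‖ ≤ (eLpNorm u 2 μ).toReal :=
  LinearMap.mkContinuous_norm_le _ ENNReal.toReal_nonneg _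

theorem abs_pairing_le {μ : Measure E3} {u : E3 → ℝ} (hu : MemLp u 2 μ) {g : E3 → Torus m}
    (hg : Continuous g) (φ : Lp C(Torus m, ℝ) 2 μ) :
    |pairing hu hg φ| ≤ (eLpNorm u 2 μ).toReal *
      (eLpNorm (fun x => φ x (g x)) 2 μ).toReal :=
  abs_integral_mul_le hu (memLp_eval (Lp.memLp φ) hg)

/-- **Two-scale compactness.** A bounded sequence of `L²(Ω)` has a weakly two-scale convergent
subsequence: the pairings with test functions converge along a subsequence by the sequential
Banach–Alaoglu theorem, and by the mean value property the limit functional is bounded for the norm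
of `L²(Ω × Y^m)`. -/
theorem exists_weakTwoScale_subseq {R : Matrix (Fin m) (Fin 3) ℝ} (hR : IsIrrational R)
    {Ω : Set E3} (hΩfin : volume Ω < ⊤)
    {η : ℕ → ℝ} (hη_pos : ∀ n, 0 < η n) (hη : Tendsto η atTop (𝓝 0)) {u : ℕ → E3 → ℝ}
    (hu : ∀ n, MemLp (u n) 2 (volume.restrict Ω)) {C : ℝ≥0}
    (hC : ∀ n, eLpNorm (u n) 2 (volume.restrict Ω) ≤ C) :
    ∃ σ : ℕ → ℕ, StrictMono σ ∧ ∃ u₀ : E3 → Torus m → ℝ,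
      WeakTwoScale R Ω (fun k => η (σ k)) (fun k => u (σ k)) u₀ := by
  have : Fact ((1 : ℝ≥0∞) ≤ 2) := ⟨by norm_num⟩
  have : Fact ((2 : ℝ≥0∞) ≠ ⊤) := ⟨by norm_num⟩
  have : IsFiniteMeasure (volume.restrict Ω) := ⟨by simpa using hΩfin⟩
  have hC' : ∀ n, (eLpNorm (u n) 2 (volume.restrict Ω)).toReal ≤ C := fun n =>
    ENNReal.toReal_le_coe_of_le_coe (hC n)
  let L : ℕ → StrongDual ℝ (Lp C(Torus m, ℝ) 2 (volume.restrict Ω)) := fun n =>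
    pairing (hu n) (continuous_fastPoint R (η n))
  obtain ⟨L₀, -, σ, hσ, hlim⟩ := WeakDual.isSeqCompact_closedBall ℝ
    (Lp C(Torus m, ℝ) 2 (volume.restrict Ω)) 0 C (x := fun n => StrongDual.toWeakDual (L n))
    (fun n => by
      rw [Set.mem_preimage, mem_closedBall_zero_iff]
      exact (norm_pairing_le (hu n) (continuous_fastPoint R (η n))).trans (hC' n))
  have hlim' : ∀ φ, Tendsto (fun k => L (σ k) φ) atTop (𝓝 (L₀ φ)) := fun φ =>
    ((WeakDual.eval_continuous φ).tendsto L₀).comp hlim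
  have hησ : Tendsto (fun k => η (σ k)) atTop (𝓝 0) := hη.comp hσ.tendsto_atTop
  -- The inclusion of `L²(Ω; C_♯(Y^m))` into `L²(Ω × Y^m)`.
  let ι : Lp C(Torus m, ℝ) 2 (volume.restrict Ω) →ₗ[ℝ]
      Lp ℝ 2 ((volume.restrict Ω).prod (torusMeasure m)) :=
    { toFun := fun φ => (memLp_uncurry (Lp.memLp φ)).toLp _
      map_add' := fun φ ψ => by
        rw [← MemLp.toLp_add, MemLp.toLp_eq_toLp_iff]
        filter_upwards [Measure.quasiMeasurePreserving_fst.ae_eq_comp (Lp.coeFn_add φ ψ)]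
          with p hp
        exact congrArg (fun c : C(Torus m, ℝ) => c p.2) hp
      map_smul' := fun c φ => by
        rw [RingHom.id_apply, ← MemLp.toLp_const_smul, MemLp.toLp_eq_toLp_iff]
        filter_upwards [Measure.quasiMeasurePreserving_fst.ae_eq_comp (Lp.coeFn_smul c φ)]
          with p hp
        exact congrArg (fun c : C(Torus m, ℝ) => c p.2) hp }
  -- Cauchy–Schwarz gives `(L (σ k) φ)² ≤ C² ∫ φ(x, R x / η)² dx`; the mean value property of
  -- `φ²` identifies the limit of the right-hand side.
  have hbound : ∀ φ, |L₀ φ| ≤ C * ‖ι φ‖ := by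
    intro φ
    refine abs_le_of_sq_le_sq ?_ (by positivity)
    have h1 : Tendsto (fun k => (L (σ k) φ) ^ 2) atTop (𝓝 ((L₀ φ) ^ 2)) := (hlim' φ).pow 2
    have h2 : Tendsto (fun k => (C : ℝ) ^ 2 *
        ∫ x in Ω, (φ x * φ x) (fastPoint R (η (σ k)) x)) atTop
        (𝓝 ((C : ℝ) ^ 2 * ∫ p, (φ p.1 * φ p.1) p.2
          ∂((volume.restrict Ω).prod (torusMeasure m)))) :=
      (tendsto_integral_eval hR (fun k => hη_pos _) hησ hΩfin
        (integrable_sq_of_memLp (Lp.memLp φ))).const_mul _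
    have h3 : ‖ι φ‖ ^ 2 = ∫ p, (φ p.1 * φ p.1) p.2
        ∂((volume.restrict Ω).prod (torusMeasure m)) := by
      change ‖(memLp_uncurry (Lp.memLp φ)).toLp _‖ ^ 2 = _
      rw [Lp.norm_toLp, toReal_eLpNorm_two_sq (memLp_uncurry (Lp.memLp φ))]
      rfl
    rw [mul_pow, h3]
    refine le_of_tendsto_of_tendsto' h1 h2 fun k => ?_
    have h4 := abs_pairing_le (hu (σ k)) (continuous_fastPoint R (η (σ k))) φ
    have h5 := toReal_eLpNorm_two_sq (memLp_eval (Lp.memLp φ) (continuous_fastPoint R (η (σ k))))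
    calc (L (σ k) φ) ^ 2 = |L (σ k) φ| ^ 2 := (sq_abs _).symm
      _ ≤ (C * (eLpNorm (fun x => φ x (fastPoint R (η (σ k)) x)) 2
          (volume.restrict Ω)).toReal) ^ 2 := by
        refine pow_le_pow_left₀ (abs_nonneg _) (h4.trans ?_) 2
        exact mul_le_mul_of_nonneg_right (hC' _) ENNReal.toReal_nonneg
      _ = _ := by rw [mul_pow, h5]; rfl
  obtain ⟨w, hw⟩ := exists_inner_eq_of_abs_le ι
    (L₀ : Lp C(Torus m, ℝ) 2 (volume.restrict Ω) →ₗ[ℝ] ℝ) C hbound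
  refine ⟨σ, hσ, fun x y => w (x, y), fun k => hu _, Lp.memLp w, fun φ hφ => ?_⟩
  have h1 := hlim' (hφ.toLp φ)
  have h2 : L₀ (hφ.toLp φ) = ∫ p : E3 × Torus m, w (p.1, p.2) * φ p.1 p.2
      ∂((volume.restrict Ω).prod (torusMeasure m)) := by
    refine (hw (hφ.toLp φ)).trans ?_
    rw [L2.inner_def]
    refine integral_congr_ae ?_
    filter_upwards [(memLp_uncurry (Lp.memLp (hφ.toLp φ))).coeFn_toLp,
      Measure.quasiMeasurePreserving_fst.ae_eq_comp hφ.coeFn_toLp] with p h3 h4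
    change inner ℝ (w p) ((memLp_uncurry (Lp.memLp (hφ.toLp φ))).toLp _ p) = _
    rw [h3]
    have h5 := congrArg (fun c : C(Torus m, ℝ) => c p.2) h4
    simp only [Function.comp_apply] at h5
    rw [h5]
    simp [mul_comm]
  rw [← h2]
  refine h1.congr fun k => ?_
  rw [pairing_apply]
  refine integral_congr_ae ?_
  filter_upwards [hφ.coeFn_toLp] with x hx
  rw [hx]

/-! ### Translation estimates for Sobolev functions, by duality -/

/-- The `L²(U)` functions that agree almost everywhere with a test function on `U`. -/
def testFunctions (U : Set E3) : Submodule ℝ (Lp ℝ 2 (volume.restrict U)) where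
  carrier := {v | ∃ φ : E3 → ℝ, ContDiff ℝ ∞ φ ∧ HasCompactSupport φ ∧ tsupport φ ⊆ U ∧
    v =ᵐ[volume.restrict U] φ}
  zero_mem' := ⟨0, contDiff_const, HasCompactSupport.zero, by simp [tsupport], Lp.coeFn_zero _ _ _⟩
  add_mem' := by
    rintro v w ⟨φ, h1, h2, h3, h4⟩ ⟨ψ, k1, k2, k3, k4⟩
    exact ⟨φ + ψ, h1.add k1, h2.add k2, (tsupport_add φ ψ).trans (Set.union_subset h3 k3),
      (Lp.coeFn_add v w).trans (h4.add k4)⟩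
  smul_mem' := by
    rintro c v ⟨φ, h1, h2, h3, h4⟩
    exact ⟨c • φ, h1.const_smul c, h2.smul_left (f := fun _ => c),
      (tsupport_smul_subset_right (fun _ => c) φ).trans h3,
      (Lp.coeFn_smul c v).trans (h4.const_smul c)⟩

theorem memLp_of_test {φ : E3 → ℝ} (h1 : ContDiff ℝ ∞ φ) (h2 : HasCompactSupport φ)
    (μ : Measure E3) [IsFiniteMeasureOnCompacts μ] : MemLp φ 2 μ :=
  h1.continuous.memLp_of_hasCompactSupport h2

theorem memLp_fderiv_of_test {φ : E3 → ℝ} (h1 : ContDiff ℝ ∞ φ) (h2 : HasCompactSupport φ)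
    (μ : Measure E3) [IsFiniteMeasureOnCompacts μ] (a : E3) :
    MemLp (fun x => fderiv ℝ φ x a) 2 μ := by
  have hc : Continuous (fderiv ℝ φ) := h1.continuous_fderiv (by simp)
  exact Continuous.memLp_of_hasCompactSupport (by fun_prop) (h2.fderiv_apply ℝ a)

/-- Density of the test functions: by the fundamental lemma of the calculus of variations, nothing
is orthogonal to them. -/
theorem topologicalClosure_testFunctions {U : Set E3} (hU : IsOpen U) :
    (testFunctions U).topologicalClosure = ⊤ := by
  rw [Submodule.topologicalClosure_eq_top_iff, Submodule.eq_bot_iff]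
  intro v hv
  have hloc : LocallyIntegrableOn v U volume := by
    have : LocallyIntegrable v (volume.restrict U) := (Lp.memLp v).locallyIntegrable (by norm_num)
    exact locallyIntegrableOn_of_locallyIntegrable_restrict this
  have h := hU.ae_eq_zero_of_integral_contDiff_smul_eq_zero hloc (by
    intro φ h1 h2 h3
    have hφ := memLp_of_test h1 h2 (volume.restrict U)
    have hz := (Submodule.mem_orthogonal _ v).mp hv (hφ.toLp φ) ⟨φ, h1, h2, h3, hφ.coeFn_toLp⟩
    rw [← Lp.toLp_coeFn v (Lp.memLp v), inner_toLp_eq_integral hφ (Lp.memLp v)] at hz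
    rw [← hz]
    refine (setIntegral_eq_integral_of_forall_compl_eq_zero fun x hx => ?_).symm
    rw [image_eq_zero_of_notMem_tsupport fun h => hx (h3 h), zero_smul])
  rw [Lp.eq_zero_iff_ae_eq_zero]
  exact (ae_restrict_iff' hU.measurableSet).mpr h

/-- The `L²(U)` norm is determined by duality with the test functions on `U`. -/
theorem toReal_eLpNorm_le_of_forall_test {U : Set E3} (hU : IsOpen U) {d : E3 → ℝ}
    (hd : MemLp d 2 (volume.restrict U)) {M : ℝ} (hM : 0 ≤ M)
    (h : ∀ φ : E3 → ℝ, ContDiff ℝ ∞ φ → HasCompactSupport φ → tsupport φ ⊆ U →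
      |∫ x in U, d x * φ x| ≤ M * (eLpNorm φ 2 (volume.restrict U)).toReal) :
    (eLpNorm d 2 (volume.restrict U)).toReal ≤ M := by
  have key : ∀ v : Lp ℝ 2 (volume.restrict U), |inner ℝ (hd.toLp d) v| ≤ M * ‖v‖ := by
    intro v
    have hcl : IsClosed {v : Lp ℝ 2 (volume.restrict U) |
        |inner ℝ (hd.toLp d) v| ≤ M * ‖v‖} :=
      isClosed_le (by fun_prop) (by fun_prop)
    have hv : v ∈ closure (testFunctions U : Set (Lp ℝ 2 (volume.restrict U))) := by
      rw [← Submodule.topologicalClosure_coe, topologicalClosure_testFunctions hU]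
      trivial
    refine closure_minimal ?_ hcl hv
    rintro w ⟨φ, h1, h2, h3, h4⟩
    have hφ := memLp_of_test h1 h2 (volume.restrict U)
    have hw : w = hφ.toLp φ := Lp.ext (h4.trans hφ.coeFn_toLp.symm)
    rw [Set.mem_ofPred_eq, hw, inner_toLp_eq_integral hd hφ, Lp.norm_toLp]
    exact h φ h1 h2 h3
  have h1 := key (hd.toLp d)
  rw [real_inner_self_eq_norm_sq, Lp.norm_toLp, abs_of_nonneg (by positivity), sq] at h1
  rcases (ENNReal.toReal_nonneg (a := eLpNorm d 2 (volume.restrict U))).eq_or_lt with h0 | h0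
  · rwa [← h0]
  · exact le_of_mul_le_mul_right h1 h0

theorem hasDerivAt_integral_translate {Ω : Set E3} {f : E3 → ℝ}
    (hf : Integrable f (volume.restrict Ω)) {φ : E3 → ℝ} (h1 : ContDiff ℝ ∞ φ)
    (h2 : HasCompactSupport φ) (h : E3) (s : ℝ) :
    HasDerivAt (fun s : ℝ => ∫ x in Ω, f x * φ (x - s • h))
      (-∫ x in Ω, f x * fderiv ℝ φ (x - s • h) h) s := by
  have hc : Continuous (fderiv ℝ φ) := h1.continuous_fderiv (by simp)
  obtain ⟨C, hC⟩ := hc.bounded_above_of_compact_support (h2.fderiv ℝ)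
  obtain ⟨C', hC'⟩ := h1.continuous.bounded_above_of_compact_support h2
  rw [← integral_neg]
  refine (hasDerivAt_integral_of_dominated_loc_of_deriv_le
    (F := fun (s : ℝ) x => f x * φ (x - s • h))
    (F' := fun (s : ℝ) x => -(f x * fderiv ℝ φ (x - s • h) h))
    (bound := fun x => ‖f x‖ * (C * ‖h‖)) (s := Set.univ) univ_mem ?_ ?_ ?_ ?_ ?_ ?_).2
  · refine Eventually.of_forall fun t => hf.1.mul ?_
    exact (h1.continuous.comp (by fun_prop)).aestronglyMeasurable
  · refine (hf.norm.mul_const C').mono' (hf.1.mul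
      (h1.continuous.comp (by fun_prop)).aestronglyMeasurable) (Eventually.of_forall fun x => ?_)
    rw [norm_mul]
    exact mul_le_mul_of_nonneg_left (hC' _) (norm_nonneg _)
  · refine (hf.1.mul ?_).neg
    exact Continuous.aestronglyMeasurable (by fun_prop)
  · refine Eventually.of_forall fun x t _ => ?_
    rw [norm_neg, norm_mul]
    exact mul_le_mul_of_nonneg_left ((ContinuousLinearMap.le_opNorm _ _).trans
      (mul_le_mul_of_nonneg_right (hC _) (norm_nonneg _))) (norm_nonneg _)
  · exact hf.norm.mul_const _
  · refine Eventually.of_forall fun x t _ => ?_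
    have e1 : HasDerivAt (fun t : ℝ => x - t • h) (-h) t := by
      simpa using ((hasDerivAt_id t).smul_const h).const_sub x
    have e2 := ((h1.differentiable (by simp)) (x - t • h)).hasFDerivAt.comp_hasDerivAt t e1
    simpa using e2.const_mul (f x)

/-- The weak gradient integrates by parts against directional derivatives in any direction. -/
theorem weakGradient_direction {Ω : Set E3} {f : E3 → ℝ} {g : E3 → E3} (hfg : IsW12 Ω f g)
    {φ : E3 → ℝ} (h1 : ContDiff ℝ ∞ φ) (h2 : HasCompactSupport φ) (h3 : tsupport φ ⊆ Ω) (h : E3) :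
    ∫ x in Ω, f x * fderiv ℝ φ x h = -∫ x in Ω, inner ℝ (g x) h * φ x := by
  have hfd := memLp_fderiv_of_test h1 h2 (volume.restrict Ω)
  have hφ := memLp_of_test h1 h2 (volume.restrict Ω)
  have hg : ∀ i, MemLp (fun x => g x i) 2 (volume.restrict Ω) := hfg.memLp_grad.eval_piLp
  have e : h = ∑ i : Fin 3, h i • EuclideanSpace.single i (1 : ℝ) := by
    ext j
    fin_cases j <;> simp [Fin.sum_univ_three]
  have e1 : ∀ x, f x * fderiv ℝ φ x h =
      ∑ i : Fin 3, h i * (f x * fderiv ℝ φ x (EuclideanSpace.single i 1)) := by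
    intro x
    conv_lhs => rw [e]
    simp only [map_sum, map_smul, smul_eq_mul, Finset.mul_sum]
    exact Finset.sum_congr rfl fun i _ => by ring
  have e2 : ∀ x, inner ℝ (g x) h * φ x = ∑ i : Fin 3, h i * (g x i * φ x) := by
    intro x
    simp only [PiLp.inner_apply, RCLike.inner_apply, conj_trivial, Finset.sum_mul]
    exact Finset.sum_congr rfl fun i _ => by ring
  simp only [e1, e2]
  rw [integral_finsetSum _ fun i _ =>
      (integrable_mul_of_memLp_two hfg.memLp (hfd _)).const_mul (h i),
    integral_finsetSum _ fun i _ => (integrable_mul_of_memLp_two (hg i) hφ).const_mul (h i),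
    ← Finset.sum_neg_distrib]
  refine Finset.sum_congr rfl fun i _ => ?_
  rw [integral_const_mul, integral_const_mul, hfg.weakGradient φ h1 h2 h3 i, mul_neg]

/-- Translating a Sobolev function along `h` changes its pairing with a test function by at most
`‖h‖ ‖∇f‖ ‖φ‖`, as long as the support of `φ` stays in `Ω` along the translation: this is the mean
value inequality for `s ↦ ∫ f(x) φ(x - s h) dx`, whose derivative is `∫ (∇f · h) φ(x - s h) dx`. -/
theorem abs_integral_translate_sub_le {Ω : Set E3} (hΩfin : volume Ω < ⊤) {f : E3 → ℝ}
    {g : E3 → E3} (hfg : IsW12 Ω f g) {U : Set E3} {h : E3}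
    (hUh : ∀ x ∈ U, ∀ s ∈ Set.Icc (0 : ℝ) 1, x + s • h ∈ Ω) {φ : E3 → ℝ}
    (h1 : ContDiff ℝ ∞ φ) (h2 : HasCompactSupport φ) (h3 : tsupport φ ⊆ U) :
    |(∫ x in Ω, f x * φ (x - h)) - ∫ x in Ω, f x * φ x| ≤
      ‖h‖ * (eLpNorm g 2 (volume.restrict Ω)).toReal * (eLpNorm φ 2 volume).toReal := by
  have : IsFiniteMeasure (volume.restrict Ω) := ⟨by simpa using hΩfin⟩
  have hf : Integrable f (volume.restrict Ω) := hfg.memLp.integrable (by norm_num)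
  have hder := hasDerivAt_integral_translate hf h1 h2 h
  have hbound : ∀ s ∈ Set.Ico (0 : ℝ) 1, ‖-∫ x in Ω, f x * fderiv ℝ φ (x - s • h) h‖ ≤
      ‖h‖ * (eLpNorm g 2 (volume.restrict Ω)).toReal * (eLpNorm φ 2 volume).toReal := by
    intro s hs
    have k1 : ContDiff ℝ ∞ fun x => φ (x - s • h) := h1.comp (contDiff_id.sub contDiff_const)
    have k2 : HasCompactSupport fun x => φ (x - s • h) :=
      h2.comp_homeomorph (Homeomorph.subRight (s • h))
    have k3 : tsupport (fun x => φ (x - s • h)) ⊆ Ω := by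
      have e : tsupport (fun x => φ (x - s • h)) =
          Homeomorph.subRight (s • h) ⁻¹' tsupport φ :=
        tsupport_comp_eq_preimage φ (Homeomorph.subRight (s • h))
      rw [e]
      intro x hx
      have := hUh _ (h3 hx) s ⟨hs.1, hs.2.le⟩
      simpa using this
    have k4 := weakGradient_direction hfg k1 k2 k3 h
    simp only [fderiv_comp_sub] at k4
    rw [k4, neg_neg]
    have hφs : MemLp (fun x => φ (x - s • h)) 2 volume := memLp_of_test k1 k2 _
    have hgh : MemLp (fun x => inner ℝ (g x) h) 2 (volume.restrict Ω) :=
      (hfg.memLp_grad.inner_const h)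
    refine (abs_integral_mul_le hgh (hφs.restrict Ω)).trans ?_
    refine mul_le_mul ?_ ?_ ENNReal.toReal_nonneg (by positivity)
    · have e : eLpNorm (fun x => inner ℝ (g x) h) 2 (volume.restrict Ω) ≤
          ENNReal.ofReal ‖h‖ * eLpNorm g 2 (volume.restrict Ω) :=
        eLpNorm_le_mul_eLpNorm_of_ae_le_mul (Eventually.of_forall fun x => by
          rw [mul_comm]; exact norm_inner_le_norm _ _) 2
      refine (ENNReal.toReal_mono (ENNReal.mul_ne_top ENNReal.ofReal_ne_top
        hfg.memLp_grad.2.ne) e).trans_eq ?_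
      rw [ENNReal.toReal_mul, ENNReal.toReal_ofReal (norm_nonneg _)]
    · refine ENNReal.toReal_mono (memLp_of_test h1 h2 volume).2.ne ?_
      refine (eLpNorm_mono_measure _ Measure.restrict_le_self).trans_eq ?_
      exact eLpNorm_comp_measurePreserving h1.continuous.aestronglyMeasurable
        (measurePreserving_sub_right volume (s • h))
  have := norm_image_sub_le_of_norm_deriv_le_segment_01'
    (fun s _ => (hder s).hasDerivWithinAt) hbound
  simpa using! this

/-! ### Averages over inward translations -/

theorem memLp_indicator {Ω : Set E3} (hΩ : IsOpen Ω) {f : E3 → ℝ}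
    (hf : MemLp f 2 (volume.restrict Ω)) : MemLp (Ω.indicator f) 2 volume :=
  (memLp_indicator_iff_restrict hΩ.measurableSet).mpr hf

/-- The translation estimate `‖f(· + h) - f‖_{L²(U)} ≤ ‖h‖ ‖∇f‖_{L²(Ω)}`, valid when the segments
`x + [0, 1] h`, `x ∈ U`, stay in `Ω`. -/
theorem toReal_eLpNorm_translate_sub_le {Ω : Set E3} (hΩ : IsOpen Ω) (hΩfin : volume Ω < ⊤)
    {f : E3 → ℝ} {g : E3 → E3} (hfg : IsW12 Ω f g) {U : Set E3} (hU : IsOpen U) {h : E3}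
    (hUh : ∀ x ∈ U, ∀ s ∈ Set.Icc (0 : ℝ) 1, x + s • h ∈ Ω) :
    (eLpNorm (fun x => Ω.indicator f (x + h) - Ω.indicator f x) 2 (volume.restrict U)).toReal ≤
      ‖h‖ * (eLpNorm g 2 (volume.restrict Ω)).toReal := by
  have hF := memLp_indicator hΩ hfg.memLp
  have hFh : MemLp (fun x => Ω.indicator f (x + h)) 2 volume :=
    hF.comp_measurePreserving (measurePreserving_add_right volume h)
  refine toReal_eLpNorm_le_of_forall_test hU ((hFh.sub hF).restrict U) (by positivity)
    fun φ h1 h2 h3 => ?_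
  have hφ := memLp_of_test h1 h2 volume
  have hφ0 : ∀ x ∉ U, φ x = 0 := fun x hx =>
    image_eq_zero_of_notMem_tsupport fun h => hx (h3 h)
  have key := abs_integral_translate_sub_le hΩfin hfg hUh h1 h2 h3
  have e1 : ∀ k : E3, ∫ x in Ω, f x * φ (x - k) = ∫ x, Ω.indicator f (x + k) * φ x := by
    intro k
    rw [← integral_indicator hΩ.measurableSet,
      ← integral_add_right_eq_self (μ := volume)
        (fun x => Ω.indicator (fun x => f x * φ (x - k)) x) k]
    refine integral_congr_ae (Eventually.of_forall fun x => ?_)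
    by_cases hx : x + k ∈ Ω <;> simp [hx]
  have e2 : eLpNorm φ 2 (volume.restrict U) = eLpNorm φ 2 volume :=
    eLpNorm_restrict_eq_of_support_subset fun x hx => by
      by_contra hxU; exact hx (hφ0 x hxU)
  have e3 : ∫ x in U, (Ω.indicator f (x + h) - Ω.indicator f x) * φ x =
      (∫ x in Ω, f x * φ (x - h)) - ∫ x in Ω, f x * φ x := by
    have e4 := e1 0
    simp only [sub_zero, add_zero] at e4
    rw [e1 h, e4, setIntegral_eq_integral_of_forall_compl_eq_zero
        (fun x hx => by rw [hφ0 x hx, mul_zero]),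
      ← integral_sub (integrable_mul_of_memLp_two hFh hφ) (integrable_mul_of_memLp_two hF hφ)]
    simp only [sub_mul]
  rw [e2]
  exact (congrArg abs e3).trans_le key

/-- The integral of `f` over the ball `x + B(h₀, δ)`, `f` being extended by zero outside `Ω`. -/
noncomputable def ballIntegral (Ω : Set E3) (h₀ : E3) (δ : ℝ) (f : E3 → ℝ) (x : E3) : ℝ :=
  ∫ h in Metric.ball h₀ δ, Ω.indicator f (x + h)

/-- As a function of `f` the ball integral at a point is the pairing with an indicator function;
hence it passes to the limit under weak convergence. -/
theorem ballIntegral_eq {Ω : Set E3} (hΩ : IsOpen Ω) (h₀ : E3) (δ : ℝ) (f : E3 → ℝ) (x : E3) :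
    ballIntegral Ω h₀ δ f x =
      ∫ z in Ω, f z * (Metric.ball (x + h₀) δ).indicator (fun _ => (1 : ℝ)) z := by
  rw [ballIntegral, ← integral_indicator Metric.isOpen_ball.measurableSet,
    ← integral_indicator hΩ.measurableSet,
    ← integral_add_left_eq_self (μ := volume) (fun z => Ω.indicator (fun z => f z *
      (Metric.ball (x + h₀) δ).indicator (fun _ => (1 : ℝ)) z) z) x]
  refine integral_congr_ae (Eventually.of_forall fun h => ?_)
  have : x + h ∈ Metric.ball (x + h₀) δ ↔ h ∈ Metric.ball h₀ δ := by
    simp [Metric.mem_ball]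
  by_cases h1 : h ∈ Metric.ball h₀ δ <;> by_cases h2 : x + h ∈ Ω <;> simp [h1, h2, this]

theorem memLp_indicator_ball (μ : Measure E3) [IsFiniteMeasureOnCompacts μ] (z : E3) (δ : ℝ) :
    MemLp ((Metric.ball z δ).indicator fun _ => (1 : ℝ)) 2 μ :=
  memLp_indicator_const 2 Metric.isOpen_ball.measurableSet 1 (Or.inr measure_ball_lt_top.ne)

theorem abs_ballIntegral_le {Ω : Set E3} (hΩ : IsOpen Ω) (h₀ : E3) (δ : ℝ) {f : E3 → ℝ}
    (hf : MemLp f 2 (volume.restrict Ω)) (x : E3) :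
    |ballIntegral Ω h₀ δ f x| ≤ (eLpNorm f 2 (volume.restrict Ω)).toReal *
      (eLpNorm ((Metric.ball h₀ δ).indicator fun _ => (1 : ℝ)) 2 volume).toReal := by
  rw [ballIntegral_eq hΩ]
  refine (abs_integral_mul_le hf (memLp_indicator_ball _ _ _)).trans ?_
  refine mul_le_mul_of_nonneg_left ?_ ENNReal.toReal_nonneg
  refine ENNReal.toReal_mono (memLp_indicator_ball _ _ _).2.ne ?_
  refine (eLpNorm_mono_measure _ Measure.restrict_le_self).trans_eq ?_
  rw [eLpNorm_indicator_const Metric.isOpen_ball.measurableSet (by norm_num) (by norm_num),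
    eLpNorm_indicator_const Metric.isOpen_ball.measurableSet (by norm_num) (by norm_num),
    Measure.addHaar_ball_center, Measure.addHaar_ball_center volume h₀]

theorem integrable_translate_mul {F : E3 → ℝ} (hF : Integrable F volume) :
    Integrable (fun p : E3 × E3 => F p.1 * F (p.1 + p.2)) (volume.prod volume) :=
  (measurePreserving_prod_add volume volume).integrable_comp_of_integrable (hF.mul_prod hF)

theorem aestronglyMeasurable_ballIntegral {Ω : Set E3} (hΩ : IsOpen Ω) (h₀ : E3) (δ : ℝ)
    {f : E3 → ℝ} (hf : MemLp f 2 (volume.restrict Ω)) (μ : Measure E3) (hμ : μ ≤ volume) :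
    AEStronglyMeasurable (ballIntegral Ω h₀ δ f) μ := by
  have h1 : AEStronglyMeasurable (fun p : E3 × E3 => Ω.indicator f (p.1 + p.2))
      (volume.prod (volume.restrict (Metric.ball h₀ δ))) :=
    (memLp_indicator hΩ hf).1.comp_snd.comp_measurePreserving
      (measurePreserving_prod_add volume volume) |>.mono_measure
        (Measure.prod_mono le_rfl Measure.restrict_le_self)
  exact h1.integral_prod_right'.mono_measure hμ

/-- If every vector of the ball `B(h₀, δ)` has length at most `ε` and translates `U` inside `Ω`,
then averaging over these translations changes `f` on `U` by at most `ε ‖∇f‖`. -/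
theorem volume_ball_mul_integral_sq_le {Ω : Set E3} (hΩ : IsOpen Ω) (hΩfin : volume Ω < ⊤)
    {f : E3 → ℝ} {g : E3 → E3} (hfg : IsW12 Ω f g) {U : Set E3} (hU : IsOpen U) {h₀ : E3}
    {δ ε : ℝ} (hB : ∀ h ∈ Metric.ball h₀ δ, ‖h‖ ≤ ε ∧
      ∀ x ∈ U, ∀ s ∈ Set.Icc (0 : ℝ) 1, x + s • h ∈ Ω) {C : ℝ}
    (hfC : (eLpNorm f 2 (volume.restrict Ω)).toReal ≤ C)
    (hgC : (eLpNorm g 2 (volume.restrict Ω)).toReal ≤ C) :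
    volume.real (Metric.ball h₀ δ) * ∫ x in U, Ω.indicator f x * Ω.indicator f x ≤
      |∫ x in U, Ω.indicator f x * ballIntegral Ω h₀ δ f x| +
        volume.real (Metric.ball h₀ δ) * (C * (ε * C)) := by
  have : IsFiniteMeasure (volume.restrict Ω) := ⟨by simpa using hΩfin⟩
  have hF := memLp_indicator hΩ hfg.memLp
  have hF1 : Integrable (Ω.indicator f) volume :=
    (integrable_indicator_iff hΩ.measurableSet).mpr (hfg.memLp.integrable (by norm_num))
  have hC : 0 ≤ C := ENNReal.toReal_nonneg.trans hfC
  have hfU : (eLpNorm (Ω.indicator f) 2 (volume.restrict U)).toReal ≤ C := by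
    refine le_trans (ENNReal.toReal_mono hfg.memLp.2.ne ?_) hfC
    refine (eLpNorm_mono_measure _ Measure.restrict_le_self).trans_eq ?_
    exact eLpNorm_indicator_eq_eLpNorm_restrict hΩ.measurableSet
  have hprod : Integrable (fun p : E3 × E3 => Ω.indicator f p.1 * Ω.indicator f (p.1 + p.2))
      ((volume.restrict U).prod (volume.restrict (Metric.ball h₀ δ))) :=
    (integrable_translate_mul hF1).mono_measure
      (Measure.prod_mono Measure.restrict_le_self Measure.restrict_le_self)
  have e1 : ∫ x in U, Ω.indicator f x * ballIntegral Ω h₀ δ f x =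
      ∫ h in Metric.ball h₀ δ, ∫ x in U, Ω.indicator f x * Ω.indicator f (x + h) := by
    rw [← integral_integral_swap hprod]
    simp only [integral_const_mul]
    rfl
  have hFh : ∀ h : E3, MemLp (fun x => Ω.indicator f (x + h)) 2 volume := fun h =>
    hF.comp_measurePreserving (measurePreserving_add_right volume h)
  have e2 : ∀ h ∈ Metric.ball h₀ δ, ‖(∫ x in U, Ω.indicator f x * Ω.indicator f (x + h)) -
      ∫ x in U, Ω.indicator f x * Ω.indicator f x‖ ≤ C * (ε * C) := by
    intro h hh
    obtain ⟨hε, hUh⟩ := hB h hh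
    rw [← integral_sub (integrable_mul_of_memLp_two (hF.restrict U) ((hFh h).restrict U))
      (integrable_mul_of_memLp_two (hF.restrict U) (hF.restrict U))]
    simp only [← mul_sub]
    refine (abs_integral_mul_le (hF.restrict U) (((hFh h).sub hF).restrict U)).trans ?_
    refine mul_le_mul hfU ?_ ENNReal.toReal_nonneg hC
    refine (toReal_eLpNorm_translate_sub_le hΩ hΩfin hfg hU hUh).trans ?_
    exact mul_le_mul hε hgC ENNReal.toReal_nonneg ((norm_nonneg h).trans hε)
  have : IsFiniteMeasure (volume.restrict (Metric.ball h₀ δ)) :=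
    ⟨by
      rw [Measure.restrict_apply_univ]; exact measure_ball_lt_top⟩
  have e3 := norm_setIntegral_le_of_norm_le_const (μ := volume) measure_ball_lt_top e2
  rw [integral_sub hprod.integral_prod_right (integrable_const _), ← e1, setIntegral_const,
    smul_eq_mul, Real.norm_eq_abs, mul_comm (C * (ε * C))] at e3
  have e4 := abs_sub_abs_le_abs_sub (volume.real (Metric.ball h₀ δ) *
    ∫ x in U, Ω.indicator f x * Ω.indicator f x)
    (∫ x in U, Ω.indicator f x * ballIntegral Ω h₀ δ f x)
  rw [abs_sub_comm] at e4
  linarith [le_abs_self (volume.real (Metric.ball h₀ δ) *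
    ∫ x in U, Ω.indicator f x * Ω.indicator f x)]

/-- `U` can be pushed inside `Ω` by arbitrarily short vectors: for every `ε` there is a ball of
vectors of length at most `ε` along each of which all points of `U` can be moved without leaving
`Ω`. A whole ball of vectors is needed in order to average over it. -/
def HasInwardTranslations (Ω U : Set E3) : Prop :=
  ∀ ε > 0, ∃ (h₀ : E3) (δ : ℝ), 0 < δ ∧ ∀ h ∈ Metric.ball h₀ δ, ‖h‖ ≤ ε ∧
    ∀ x ∈ U, ∀ s ∈ Set.Icc (0 : ℝ) 1, x + s • h ∈ Ω

/-- Averages over small balls turn weak convergence into strong convergence. -/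
theorem tendsto_integral_mul_ballIntegral {Ω : Set E3} (hΩ : IsOpen Ω) {f : ℕ → E3 → ℝ}
    (hf : ∀ n, MemLp (f n) 2 (volume.restrict Ω)) {C : ℝ}
    (hfC : ∀ n, (eLpNorm (f n) 2 (volume.restrict Ω)).toReal ≤ C)
    (hweak : ∀ ψ : E3 → ℝ, MemLp ψ 2 (volume.restrict Ω) →
      Tendsto (fun n => ∫ x in Ω, f n x * ψ x) atTop (𝓝 0))
    {U : Set E3} (hUfin : volume U < ⊤) (h₀ : E3) (δ : ℝ) :
    Tendsto (fun n => ∫ x in U, Ω.indicator (f n) x * ballIntegral Ω h₀ δ (f n) x) atTop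
      (𝓝 0) := by
  have : IsFiniteMeasure (volume.restrict U) := ⟨by simpa using hUfin⟩
  set D := C * (eLpNorm ((Metric.ball h₀ δ).indicator fun _ => (1 : ℝ)) 2 volume).toReal with hD
  have hA : ∀ n x, |ballIntegral Ω h₀ δ (f n) x| ≤ D := fun n x =>
    (abs_ballIntegral_le hΩ h₀ δ (hf n) x).trans
      (mul_le_mul_of_nonneg_right (hfC n) ENNReal.toReal_nonneg)
  have hAm : ∀ n, AEStronglyMeasurable (ballIntegral Ω h₀ δ (f n)) (volume.restrict U) :=
    fun n => aestronglyMeasurable_ballIntegral hΩ h₀ δ (hf n) _ Measure.restrict_le_self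
  have hA2 : ∀ n, MemLp (ballIntegral Ω h₀ δ (f n)) 2 (volume.restrict U) := fun n =>
    MemLp.of_bound (hAm n) D (Eventually.of_forall (hA n))
  have hpt : ∀ x, Tendsto (fun n => ballIntegral Ω h₀ δ (f n) x) atTop (𝓝 0) := fun x => by
    simp only [ballIntegral_eq hΩ]
    exact hweak _ (memLp_indicator_ball _ _ _)
  have hsq : Tendsto (fun n => ∫ x in U, ballIntegral Ω h₀ δ (f n) x *
      ballIntegral Ω h₀ δ (f n) x) atTop (𝓝 0) := by
    have := tendsto_integral_of_dominated_convergence (μ := volume.restrict U)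
      (F := fun n x => ballIntegral Ω h₀ δ (f n) x * ballIntegral Ω h₀ δ (f n) x)
      (f := fun _ => 0) (fun _ => D * D) (fun n => (hAm n).mul (hAm n)) (integrable_const _)
      (fun n => Eventually.of_forall fun x => by
        rw [norm_mul]
        exact mul_le_mul (hA n x) (hA n x) (norm_nonneg _) ((abs_nonneg _).trans (hA n x)))
      (Eventually.of_forall fun x => by simpa using (hpt x).mul (hpt x))
    simpa using this
  have hnorm : Tendsto (fun n => (eLpNorm (ballIntegral Ω h₀ δ (f n)) 2
      (volume.restrict U)).toReal) atTop (𝓝 0) := by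
    have := hsq.sqrt
    rw [Real.sqrt_zero] at this
    refine this.congr fun n => ?_
    rw [← toReal_eLpNorm_two_sq (hA2 n), Real.sqrt_sq ENNReal.toReal_nonneg]
  have hfU : ∀ n, (eLpNorm (Ω.indicator (f n)) 2 (volume.restrict U)).toReal ≤ C := fun n => by
    refine le_trans (ENNReal.toReal_mono (hf n).2.ne ?_) (hfC n)
    refine (eLpNorm_mono_measure _ Measure.restrict_le_self).trans_eq ?_
    exact eLpNorm_indicator_eq_eLpNorm_restrict hΩ.measurableSet
  refine squeeze_zero_norm (fun n => ?_) (by simpa using hnorm.const_mul C)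
  refine (abs_integral_mul_le ((memLp_indicator hΩ (hf n)).restrict U) (hA2 n)).trans ?_
  exact mul_le_mul_of_nonneg_right (hfU n) ENNReal.toReal_nonneg

/-- Local form of the compactness theorem: `f n` differs little from its averages over inward
translations, and these averages converge strongly. -/
theorem tendsto_integral_sq_of_inwardTranslations {Ω : Set E3} (hΩ : IsOpen Ω)
    (hΩfin : volume Ω < ⊤) {f : ℕ → E3 → ℝ} {g : ℕ → E3 → E3} (hfg : ∀ n, IsW12 Ω (f n) (g n))
    {C : ℝ} (hfC : ∀ n, (eLpNorm (f n) 2 (volume.restrict Ω)).toReal ≤ C)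
    (hgC : ∀ n, (eLpNorm (g n) 2 (volume.restrict Ω)).toReal ≤ C)
    (hweak : ∀ ψ : E3 → ℝ, MemLp ψ 2 (volume.restrict Ω) →
      Tendsto (fun n => ∫ x in Ω, f n x * ψ x) atTop (𝓝 0))
    {U : Set E3} (hU : IsOpen U) (hUΩ : U ⊆ Ω) (hin : HasInwardTranslations Ω U) :
    Tendsto (fun n => ∫ x in U, f n x * f n x) atTop (𝓝 0) := by
  have hC : 0 ≤ C := ENNReal.toReal_nonneg.trans (hfC 0)
  have e : ∀ n, ∫ x in U, f n x * f n x =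
      ∫ x in U, Ω.indicator (f n) x * Ω.indicator (f n) x := fun n =>
    setIntegral_congr_fun hU.measurableSet fun x hx => by simp [hUΩ hx]
  rw [Metric.tendsto_atTop]
  intro ε hε
  -- Translations this short change `∫ f²` by at most `C² ε / (2 (C² + 1)) ≤ ε / 2` on average.
  obtain ⟨h₀, δ, hδ, hB⟩ := hin (ε / (2 * (C * C + 1))) (by positivity)
  set b := volume.real (Metric.ball h₀ δ) with hb
  have hb0 : 0 < b :=
    ENNReal.toReal_pos (Metric.measure_ball_pos volume h₀ hδ).ne' measure_ball_lt_top.ne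
  have h1 := tendsto_integral_mul_ballIntegral hΩ (fun n => (hfg n).memLp) hfC hweak
    ((measure_mono hUΩ).trans_lt hΩfin) h₀ δ
  obtain ⟨N, hN⟩ := Metric.tendsto_atTop.mp h1 (b * (ε / 2)) (by positivity)
  refine ⟨N, fun n hn => ?_⟩
  have h2 := volume_ball_mul_integral_sq_le hΩ hΩfin (hfg n) hU hB (hfC n) (hgC n)
  have h3 := hN n hn
  rw [dist_zero_right, Real.norm_eq_abs] at h3 ⊢
  have h4 : 0 ≤ ∫ x in U, f n x * f n x := integral_nonneg fun x => mul_self_nonneg _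
  rw [abs_of_nonneg h4, e n]
  rw [← hb] at h2
  have h5 : C * (ε / (2 * (C * C + 1)) * C) ≤ ε / 2 := by
    have : C * (ε / (2 * (C * C + 1)) * C) = (ε / 2) * (C * C / (C * C + 1)) := by
      field_simp
    rw [this]
    refine mul_le_of_le_one_right (by positivity) ?_
    rw [div_le_one (by positivity)]
    linarith
  have h6 : b * ∫ x in U, Ω.indicator (f n) x * Ω.indicator (f n) x < b * ε := by
    have := mul_le_mul_of_nonneg_left h5 hb0.le
    nlinarith
  exact lt_of_mul_lt_mul_left h6 hb0.le

/-! ### Compactness on bounded Lipschitz domains -/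

theorem hasInwardTranslations_of_ball_subset {Ω : Set E3} {p : E3} {r : ℝ} (hr : 0 < r)
    (h : Metric.ball p r ⊆ Ω) : HasInwardTranslations Ω (Ω ∩ Metric.ball p (r / 2)) := by
  intro ε hε
  refine ⟨0, min ε (r / 2), by positivity, fun v hv => ?_⟩
  rw [mem_ball_zero_iff, lt_min_iff] at hv
  refine ⟨hv.1.le, fun x hx s hs => h ?_⟩
  have h1 := hx.2
  rw [mem_ball_iff_norm] at h1 ⊢
  have h2 : ‖s • v‖ ≤ ‖v‖ := by
    rw [norm_smul, Real.norm_of_nonneg hs.1]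
    exact mul_le_of_le_one_left (norm_nonneg _) hs.2
  calc ‖x + s • v - p‖ = ‖(x - p) + s • v‖ := by congr 1; abel
    _ ≤ ‖x - p‖ + ‖s • v‖ := norm_add_le _ _
    _ < r := by linarith [hv.2]

/-- Above the graph of a `K`-Lipschitz function, all directions close to the vertical one point
inside. -/
theorem hasInwardTranslations_of_lipschitz_graph {Ω : Set E3} {p : E3} {r : ℝ} (hr : 0 < r)
    (e : E3 ≃ₗᵢ[ℝ] E3) {γ : EuclideanSpace ℝ (Fin 2) → ℝ} {K : ℝ≥0} (hγ : LipschitzWith K γ)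
    (h : Ω ∩ Metric.ball p r = {x ∈ Metric.ball p r | γ !₂[e x 0, e x 1] < e x 2}) :
    HasInwardTranslations Ω (Ω ∩ Metric.ball p (r / 2)) := by
  intro ε hε
  -- The ball of directions is centred at height `t` on the vertical axis; its radius `δ` satisfies
  -- `K δ ≤ t - δ`, so that along each direction the height grows faster than the graph.
  set t : ℝ := min ε (r / 2) / 2 with ht
  have ht0 : 0 < t := by positivity
  have htε : 2 * t ≤ ε := by rw [ht]; linarith [min_le_left ε (r / 2)]
  have htr : 2 * t ≤ r / 2 := by rw [ht]; linarith [min_le_right ε (r / 2)]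
  set δ : ℝ := t / (K + 1) with hδ
  have hδ0 : 0 < δ := by positivity
  have hKδ : (K + 1) * δ = t := by rw [hδ]; field_simp
  have hδt : δ ≤ t := by nlinarith [mul_nonneg K.2 hδ0.le, NNReal.coe_nonneg K]
  refine ⟨e.symm (EuclideanSpace.single 2 t), δ, hδ0, fun v hv => ?_⟩
  rw [mem_ball_iff_norm] at hv
  set d : E3 := e v - EuclideanSpace.single 2 t with hd
  have hdn : ‖d‖ < δ := by
    rw [← e.norm_map, map_sub, e.apply_symm_apply] at hv
    exact hv
  have hvn : ‖v‖ ≤ 2 * t := by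
    have e1 : e v = EuclideanSpace.single 2 t + d := by rw [hd]; abel
    calc ‖v‖ = ‖e v‖ := (e.norm_map v).symm
      _ ≤ ‖(EuclideanSpace.single 2 t : E3)‖ + ‖d‖ := by rw [e1]; exact norm_add_le _ _
      _ ≤ 2 * t := by
        rw [PiLp.norm_single, Real.norm_of_nonneg ht0.le]; linarith
  refine ⟨hvn.trans htε, fun x hx s hs => ?_⟩
  have hx1 := hx.2
  rw [mem_ball_iff_norm] at hx1
  have hball : x + s • v ∈ Metric.ball p r := by
    rw [mem_ball_iff_norm]
    have h2 : ‖s • v‖ ≤ ‖v‖ := by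
      rw [norm_smul, Real.norm_of_nonneg hs.1]
      exact mul_le_of_le_one_left (norm_nonneg _) hs.2
    calc ‖x + s • v - p‖ = ‖(x - p) + s • v‖ := by congr 1; abel
      _ ≤ ‖x - p‖ + ‖s • v‖ := norm_add_le _ _
      _ < r := by linarith
  have hxr : x ∈ {x ∈ Metric.ball p r | γ !₂[e x 0, e x 1] < e x 2} := by
    rw [← h]
    exact ⟨hx.1, Metric.ball_subset_ball (by linarith) hx.2⟩
  have hgr : γ !₂[e x 0, e x 1] < e x 2 := hxr.2
  have hd2 : |d 2| ≤ δ := (PiLp.norm_apply_le d 2).trans hdn.le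
  have hv0 : e v 0 = d 0 := by simp [hd]
  have hv1 : e v 1 = d 1 := by simp [hd]
  have hv2 : e v 2 = t + d 2 := by simp [hd]
  have hdist : dist (!₂[e (x + s • v) 0, e (x + s • v) 1] : EuclideanSpace ℝ (Fin 2))
      !₂[e x 0, e x 1] ≤ s * δ := by
    rw [EuclideanSpace.dist_eq, Real.sqrt_le_left (by have := hs.1; positivity)]
    have hsq : d 0 ^ 2 + d 1 ^ 2 ≤ δ ^ 2 := by
      have h3 : ‖d‖ ^ 2 ≤ δ ^ 2 := pow_le_pow_left₀ (norm_nonneg _) hdn.le 2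
      rw [EuclideanSpace.norm_sq_eq, Fin.sum_univ_three] at h3
      simp only [Real.norm_eq_abs, sq_abs] at h3
      nlinarith [sq_nonneg (d 2)]
    simp only [Fin.sum_univ_two, map_add, map_smul, PiLp.add_apply, PiLp.smul_apply, hv0, hv1,
      Real.dist_eq, sq_abs, smul_eq_mul, Matrix.cons_val_zero, Matrix.cons_val_one]
    nlinarith [sq_nonneg s]
  have hlip := (hγ.dist_le_mul _ _).trans (mul_le_mul_of_nonneg_left hdist K.2)
  rw [Real.dist_eq] at hlip
  have hmem : x + s • v ∈ {x ∈ Metric.ball p r | γ !₂[e x 0, e x 1] < e x 2} := by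
    refine ⟨hball, ?_⟩
    have h5 : e (x + s • v) 2 = e x 2 + s * (t + d 2) := by
      simp [map_add, map_smul, hv2]
    rw [h5]
    have h6 : s * (K * δ) ≤ s * (t + d 2) :=
      mul_le_mul_of_nonneg_left (by nlinarith [neg_le_of_abs_le hd2]) hs.1
    have h7 := le_of_abs_le hlip
    have h8 : (K : ℝ) * (s * δ) = s * (K * δ) := by ring
    change γ _ - γ _ ≤ (K : ℝ) * (s * δ) at h7
    linarith
  rw [← h] at hmem
  exact hmem.1

theorem exists_hasInwardTranslations {Ω : Set E3} (hΩ : IsOpen Ω) (hlip : HasLipschitzBoundary Ω)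
    {p : E3} (hp : p ∈ closure Ω) :
    ∃ r > 0, HasInwardTranslations Ω (Ω ∩ Metric.ball p r) := by
  by_cases hpΩ : p ∈ Ω
  · obtain ⟨r, hr, h⟩ := Metric.isOpen_iff.mp hΩ p hpΩ
    exact ⟨r / 2, by positivity, hasInwardTranslations_of_ball_subset hr h⟩
  · obtain ⟨r, hr, e, γ, K, hγ, h⟩ := hlip p (by rw [hΩ.frontier_eq]; exact ⟨hp, hpΩ⟩)
    exact ⟨r / 2, by positivity, hasInwardTranslations_of_lipschitz_graph hr e hγ h⟩

/-- **Rellich–Kondrachov** for bounded Lipschitz domains: a bounded sequence of `W^{1,2}(Ω)` that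
converges weakly to zero in `L²(Ω)` converges strongly. -/
theorem tendsto_eLpNorm_of_weak {Ω : Set E3} (hΩ : IsOpen Ω) (hbdd : Bornology.IsBounded Ω)
    (hlip : HasLipschitzBoundary Ω) {f : ℕ → E3 → ℝ} {g : ℕ → E3 → E3}
    (hfg : ∀ n, IsW12 Ω (f n) (g n))
    {C : ℝ} (hfC : ∀ n, (eLpNorm (f n) 2 (volume.restrict Ω)).toReal ≤ C)
    (hgC : ∀ n, (eLpNorm (g n) 2 (volume.restrict Ω)).toReal ≤ C)
    (hweak : ∀ ψ : E3 → ℝ, MemLp ψ 2 (volume.restrict Ω) →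
      Tendsto (fun n => ∫ x in Ω, f n x * ψ x) atTop (𝓝 0)) :
    Tendsto (fun n => (eLpNorm (f n) 2 (volume.restrict Ω)).toReal) atTop (𝓝 0) := by
  have hΩfin : volume Ω < ⊤ := hbdd.measure_lt_top
  have hint : ∀ n, Integrable (fun x => f n x * f n x) (volume.restrict Ω) := fun n =>
    integrable_mul_of_memLp_two (hfg n).memLp (hfg n).memLp
  have hlin : ∀ (n : ℕ) (U : Set E3), U ⊆ Ω →
      ENNReal.ofReal (∫ x in U, f n x * f n x) = ∫⁻ x in U, ENNReal.ofReal (f n x * f n x) :=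
    fun n U hU => ofReal_integral_eq_lintegral_ofReal ((hint n).mono_measure
      (Measure.restrict_mono_set _ hU)) (Eventually.of_forall fun x => mul_self_nonneg _)
  -- The convergence is local on the compact set `closure Ω`.
  have hcpt : IsCompact (closure Ω) := hbdd.isCompact_closure
  have key : Tendsto (fun n => ∫⁻ x in Ω ∩ closure Ω, ENNReal.ofReal (f n x * f n x)) atTop
      (𝓝 0) := by
    refine hcpt.induction_on (p := fun S => Tendsto (fun n => ∫⁻ x in Ω ∩ S,
      ENNReal.ofReal (f n x * f n x)) atTop (𝓝 0)) ?_ ?_ ?_ ?_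
    · simp
    · intro S T hST hT
      exact tendsto_of_tendsto_of_tendsto_of_le_of_le tendsto_const_nhds hT
        (fun n => zero_le) (fun n => lintegral_mono_set (Set.inter_subset_inter_right _ hST))
    · intro S T hS hT
      have := hS.add hT
      rw [add_zero] at this
      refine tendsto_of_tendsto_of_tendsto_of_le_of_le tendsto_const_nhds this
        (fun n => zero_le) (fun n => ?_)
      rw [Set.inter_union_distrib_left]
      exact lintegral_union_le _ _ _
    · intro p hp
      obtain ⟨r, hr, hin⟩ := exists_hasInwardTranslations hΩ hlip hp
      refine ⟨Metric.ball p r, mem_nhdsWithin_of_mem_nhds (Metric.ball_mem_nhds p hr), ?_⟩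
      have h1 := tendsto_integral_sq_of_inwardTranslations hΩ hΩfin hfg hfC hgC hweak
        (hΩ.inter Metric.isOpen_ball) Set.inter_subset_left hin
      have h2 := ENNReal.tendsto_ofReal h1
      rw [ENNReal.ofReal_zero] at h2
      exact h2.congr fun n => hlin n _ Set.inter_subset_left
  rw [Set.inter_eq_left.mpr subset_closure] at key
  have h3 : Tendsto (fun n => ∫ x in Ω, f n x * f n x) atTop (𝓝 0) := by
    have := (ENNReal.tendsto_toReal ENNReal.zero_ne_top).comp key
    rw [ENNReal.toReal_zero] at this
    refine this.congr fun n => ?_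
    rw [Function.comp_apply, ← hlin n Ω subset_rfl, ENNReal.toReal_ofReal]
    exact integral_nonneg fun x => mul_self_nonneg _
  have h4 := h3.sqrt
  rw [Real.sqrt_zero] at h4
  refine h4.congr fun n => ?_
  rw [← toReal_eLpNorm_two_sq (hfg n).memLp, Real.sqrt_sq ENNReal.toReal_nonneg]

theorem IsW12.sub {Ω : Set E3} {f₁ f₂ : E3 → ℝ} {g₁ g₂ : E3 → E3} (h₁ : IsW12 Ω f₁ g₁)
    (h₂ : IsW12 Ω f₂ g₂) : IsW12 Ω (fun x => f₁ x - f₂ x) (fun x => g₁ x - g₂ x) where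
  memLp := h₁.memLp.sub h₂.memLp
  memLp_grad := h₁.memLp_grad.sub h₂.memLp_grad
  weakGradient := by
    intro φ k1 k2 k3 i
    have hfd := memLp_fderiv_of_test k1 k2 (volume.restrict Ω) (EuclideanSpace.single i 1)
    have hφ := memLp_of_test k1 k2 (volume.restrict Ω)
    simp only [sub_mul, PiLp.sub_apply]
    rw [integral_sub (integrable_mul_of_memLp_two h₁.memLp hfd)
        (integrable_mul_of_memLp_two h₂.memLp hfd),
      integral_sub (integrable_mul_of_memLp_two (h₁.memLp_grad.eval_piLp i) hφ)
        (integrable_mul_of_memLp_two (h₂.memLp_grad.eval_piLp i) hφ),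
      h₁.weakGradient φ k1 k2 k3 i, h₂.weakGradient φ k1 k2 k3 i]
    ring

/-! ### Two-scale limits of Sobolev functions and of their gradients -/

theorem ae_memLp_section {μ : Measure E3} [SFinite μ] {E : Type*} [NormedAddCommGroup E]
    {F : E3 → Torus m → E}
    (hF : MemLp (fun p : E3 × Torus m => F p.1 p.2) 2 (μ.prod (torusMeasure m))) :
    ∀ᵐ x ∂μ, MemLp (F x) 2 (torusMeasure m) := by
  have h := ((memLp_two_iff_integrable_sq_norm hF.1).mp hF).prod_right_ae
  filter_upwards [h, hF.1.prodMk_left] with x h1 h2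
  exact (memLp_two_iff_integrable_sq_norm h2).mpr h1

/-- Averaging over the cell maps `L²(Ω × Y^m)` to `L²(Ω)`. -/
theorem memLp_average {μ : Measure E3} [SFinite μ] {F : E3 → Torus m → ℝ}
    (hF : MemLp (fun p : E3 × Torus m => F p.1 p.2) 2 (μ.prod (torusMeasure m))) :
    MemLp (fun x => ∫ y, F x y ∂(torusMeasure m)) 2 μ := by
  have hm : AEStronglyMeasurable (fun x => ∫ y, F x y ∂(torusMeasure m)) μ :=
    hF.1.integral_prod_right'
  rw [memLp_two_iff_integrable_sq hm]
  have hsq := ((memLp_two_iff_integrable_sq hF.1).mp hF).integral_prod_left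
  refine hsq.mono' (hm.pow 2) ?_
  filter_upwards [ae_memLp_section hF] with x hx
  have h1 := abs_integral_mul_le hx (memLp_const (μ := torusMeasure m) (1 : ℝ))
  have h2 := toReal_eLpNorm_two_sq hx
  simp only [mul_one] at h1
  have h3 : (eLpNorm (fun _ : Torus m => (1 : ℝ)) 2 (torusMeasure m)).toReal = 1 := by
    rw [eLpNorm_const _ (by norm_num) (NeZero.ne _)]
    simp
  rw [h3, mul_one] at h1
  rw [Real.norm_of_nonneg (sq_nonneg _), ← sq_abs]
  refine (pow_le_pow_left₀ (abs_nonneg _) h1 2).trans_eq ?_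
  rw [h2]
  simp only [sq]

theorem memLp_smul_const {μ : Measure E3} {ψ : E3 → ℝ} (hψ : MemLp ψ 2 μ) (c : C(Torus m, ℝ)) :
    MemLp (fun x => ψ x • c) 2 μ :=
  (ContinuousLinearMap.toSpanSingleton ℝ c).comp_memLp' hψ

theorem WeakTwoScale.comp {R : Matrix (Fin m) (Fin 3) ℝ} {Ω : Set E3} {η : ℕ → ℝ}
    {u : ℕ → E3 → ℝ} {u₀ : E3 → Torus m → ℝ} (h : WeakTwoScale R Ω η u u₀) {σ : ℕ → ℕ}
    (hσ : StrictMono σ) : WeakTwoScale R Ω (fun k => η (σ k)) (fun k => u (σ k)) u₀ :=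
  ⟨fun k => h.memLp (σ k), h.memLp_limit, fun φ hφ => (h.tendsto φ hφ).comp hσ.tendsto_atTop⟩

theorem WeakTwoScale.tendsto_mul {R : Matrix (Fin m) (Fin 3) ℝ} {Ω : Set E3} {η : ℕ → ℝ}
    {u : ℕ → E3 → ℝ} {u₀ : E3 → Torus m → ℝ} (h : WeakTwoScale R Ω η u u₀) {ψ : E3 → ℝ}
    (hψ : MemLp ψ 2 (volume.restrict Ω)) (c : C(Torus m, ℝ)) :
    Tendsto (fun n => ∫ x in Ω, u n x * (ψ x * c (fastPoint R (η n) x))) atTop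
      (𝓝 (∫ x in Ω, ψ x * ∫ y, u₀ x y * c y ∂(torusMeasure m))) := by
  have h1 := h.tendsto _ (memLp_smul_const hψ c)
  rw [integral_prod _ (integrable_mul_of_memLp_two h.memLp_limit
    (memLp_uncurry (memLp_smul_const hψ c)))] at h1
  convert! h1 using 2
  refine integral_congr_ae (Eventually.of_forall fun x => ?_)
  simp only [ContinuousMap.smul_apply, smul_eq_mul]
  rw [← integral_const_mul]
  exact integral_congr_ae (Eventually.of_forall fun y => by ring)

/-- Two-scale limits determine weak limits: the weak limit is the cell average. -/
theorem WeakTwoScale.tendsto_weak {R : Matrix (Fin m) (Fin 3) ℝ} {Ω : Set E3} {η : ℕ → ℝ}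
    {u : ℕ → E3 → ℝ} {u₀ : E3 → Torus m → ℝ} (h : WeakTwoScale R Ω η u u₀) {ψ : E3 → ℝ}
    (hψ : MemLp ψ 2 (volume.restrict Ω)) :
    Tendsto (fun n => ∫ x in Ω, u n x * ψ x) atTop
      (𝓝 (∫ x in Ω, (∫ y, u₀ x y ∂(torusMeasure m)) * ψ x)) := by
  simpa [mul_comm] using h.tendsto_mul hψ 1

/-- The cell averages of the two-scale limits of `u n` and of `∇ u n` are a Sobolev function and its
gradient. -/
theorem isW12_average {R : Matrix (Fin m) (Fin 3) ℝ} {Ω : Set E3} {η : ℕ → ℝ}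
    {u : ℕ → E3 → ℝ} {Du : ℕ → E3 → E3} (hu : ∀ n, IsW12 Ω (u n) (Du n))
    {u₀ : E3 → Torus m → ℝ} (h₀ : WeakTwoScale R Ω η u u₀) {χ : Fin 3 → E3 → Torus m → ℝ}
    (hχ : ∀ i, WeakTwoScale R Ω η (fun n x => Du n x i) (χ i)) :
    IsW12 Ω (fun x => ∫ y, u₀ x y ∂(torusMeasure m))
      (fun x => WithLp.toLp 2 fun i => ∫ y, χ i x y ∂(torusMeasure m)) where
  memLp := memLp_average h₀.memLp_limit
  memLp_grad := MemLp.of_eval_piLp fun i => memLp_average (hχ i).memLp_limit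
  weakGradient := by
    intro φ k1 k2 k3 i
    have hfd := memLp_fderiv_of_test k1 k2 (volume.restrict Ω) (EuclideanSpace.single i 1)
    have h1 := h₀.tendsto_weak hfd
    have h2 := ((hχ i).tendsto_weak (memLp_of_test k1 k2 (volume.restrict Ω))).neg
    refine tendsto_nhds_unique h1 (h2.congr fun n => ?_)
    exact ((hu n).weakGradient φ k1 k2 k3 i).symm

/-- A sequence converging strongly in `L²(Ω)` converges strongly two-scale, to the same limit. -/
theorem strongTwoScale_of_tendsto {R : Matrix (Fin m) (Fin 3) ℝ} (hR : IsIrrational R)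
    {Ω : Set E3} (hΩfin : volume Ω < ⊤)
    {η : ℕ → ℝ} (hη_pos : ∀ n, 0 < η n) (hη : Tendsto η atTop (𝓝 0)) {u : ℕ → E3 → ℝ}
    (hu : ∀ n, MemLp (u n) 2 (volume.restrict Ω)) {v : E3 → ℝ}
    (hv : MemLp v 2 (volume.restrict Ω))
    (huv : Tendsto (fun n => (eLpNorm (fun x => u n x - v x) 2 (volume.restrict Ω)).toReal) atTop
      (𝓝 0)) : StrongTwoScale R Ω η u (fun x _ => v x) where
  weak :=
    { memLp := hu
      memLp_limit := hv.comp_fst (torusMeasure m)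
      tendsto := by
        intro φ hφ
        have h1 : Integrable (fun x => v x • φ x) (volume.restrict Ω) :=
          memLp_one_iff_integrable.mp (hφ.smul hv)
        have h2 := tendsto_integral_eval hR hη_pos hη hΩfin h1
        simp only [ContinuousMap.smul_apply, smul_eq_mul] at h2
        have h3 : Tendsto (fun n => ∫ x in Ω, (u n x - v x) * φ x (fastPoint R (η n) x)) atTop
            (𝓝 0) := by
          refine squeeze_zero_norm (fun n => ?_)
            (by simpa using huv.mul_const (eLpNorm φ 2 (volume.restrict Ω)).toReal)
          refine (abs_integral_mul_le ((hu n).sub hv)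
            (memLp_eval hφ (continuous_fastPoint _ _))).trans ?_
          refine mul_le_mul_of_nonneg_left ?_ ENNReal.toReal_nonneg
          exact ENNReal.toReal_mono hφ.2.ne (eLpNorm_mono fun x => (φ x).norm_coe_le_norm _)
        have h4 := h3.add h2
        rw [zero_add] at h4
        refine h4.congr fun n => ?_
        have hφn := memLp_eval hφ (continuous_fastPoint R (η n))
        refine (integral_add (integrable_mul_of_memLp_two ((hu n).sub hv) hφn)
          (integrable_mul_of_memLp_two hv hφn)).symm.trans ?_
        refine integral_congr_ae (Eventually.of_forall fun x => ?_)
        simp only [Pi.sub_apply]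
        ring }
  norm_tendsto := by
    have : Fact ((1 : ℝ≥0∞) ≤ 2) := ⟨by norm_num⟩
    have e : eLpNorm (fun p : E3 × Torus m => v p.1) 2
        ((volume.restrict Ω).prod (torusMeasure m)) = eLpNorm v 2 (volume.restrict Ω) :=
      eLpNorm_comp_measurePreserving hv.1 measurePreserving_fst
    rw [e]
    have h1 : Tendsto (fun n => eLpNorm (u n - v) 2 (volume.restrict Ω)) atTop (𝓝 0) := by
      rw [← ENNReal.toReal_zero] at huv
      exact (ENNReal.tendsto_toReal_iff (fun n => ((hu n).sub hv).2.ne) ENNReal.zero_ne_top).mp huv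
    have h2 := ((Lp.tendsto_Lp_iff_tendsto_eLpNorm'' u hu v hv).mpr h1).norm
    simp only [Lp.norm_toLp] at h2
    exact (ENNReal.tendsto_toReal_iff (fun n => (hu n).2.ne) hv.2.ne).mp h2

theorem toReal_eLpNorm_sub_le {E : Type*} [NormedAddCommGroup E] {μ : Measure E3} {f g : E3 → E}
    (hf : MemLp f 2 μ) (hg : MemLp g 2 μ) :
    (eLpNorm (fun x => f x - g x) 2 μ).toReal ≤
      (eLpNorm f 2 μ).toReal + (eLpNorm g 2 μ).toReal := by
  rw [← ENNReal.toReal_add hf.2.ne hg.2.ne]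
  exact ENNReal.toReal_mono (ENNReal.add_ne_top.mpr ⟨hf.2.ne, hg.2.ne⟩)
    (eLpNorm_sub_le hf.1 hg.1 (by norm_num))

/-- For a bounded sequence of `W^{1,2}(Ω)`, weak two-scale convergence of the functions and of
their gradients gives strong two-scale convergence of the functions. -/
theorem strongTwoScale_average {R : Matrix (Fin m) (Fin 3) ℝ} (hR : IsIrrational R) {Ω : Set E3}
    (hΩ : IsOpen Ω) (hbdd : Bornology.IsBounded Ω) (hlip : HasLipschitzBoundary Ω)
    {η : ℕ → ℝ} (hη_pos : ∀ n, 0 < η n) (hη : Tendsto η atTop (𝓝 0))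
    {u : ℕ → E3 → ℝ} {Du : ℕ → E3 → E3} (hu : ∀ n, IsW12 Ω (u n) (Du n)) {C : ℝ}
    (huC : ∀ n, (eLpNorm (u n) 2 (volume.restrict Ω)).toReal ≤ C)
    (hDuC : ∀ n, (eLpNorm (Du n) 2 (volume.restrict Ω)).toReal ≤ C)
    {u₀ : E3 → Torus m → ℝ} (h₀ : WeakTwoScale R Ω η u u₀) {χ : Fin 3 → E3 → Torus m → ℝ}
    (hχ : ∀ i, WeakTwoScale R Ω η (fun n x => Du n x i) (χ i)) :
    StrongTwoScale R Ω η u (fun x _ => ∫ y, u₀ x y ∂(torusMeasure m)) := by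
  have hv := isW12_average hu h₀ hχ
  set v : E3 → ℝ := fun x => ∫ y, u₀ x y ∂(torusMeasure m) with hv_def
  set Dv : E3 → E3 := fun x => WithLp.toLp 2 fun i => ∫ y, χ i x y ∂(torusMeasure m) with hDv_def
  refine strongTwoScale_of_tendsto hR hbdd.measure_lt_top hη_pos hη (fun n => (hu n).memLp)
    hv.memLp ?_
  refine tendsto_eLpNorm_of_weak hΩ hbdd hlip (fun n => (hu n).sub hv)
    (C := C + ((eLpNorm v 2 (volume.restrict Ω)).toReal +
      (eLpNorm Dv 2 (volume.restrict Ω)).toReal)) (fun n => ?_) (fun n => ?_) fun ψ hψ => ?_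
  · refine (toReal_eLpNorm_sub_le (hu n).memLp hv.memLp).trans ?_
    linarith [huC n, ENNReal.toReal_nonneg (a := eLpNorm Dv 2 (volume.restrict Ω))]
  · refine (toReal_eLpNorm_sub_le (hu n).memLp_grad hv.memLp_grad).trans ?_
    linarith [hDuC n, ENNReal.toReal_nonneg (a := eLpNorm v 2 (volume.restrict Ω))]
  · have h1 := (h₀.tendsto_weak hψ).sub_const (∫ x in Ω, v x * ψ x)
    rw [sub_self] at h1
    refine h1.congr fun n => ?_
    rw [← integral_sub (integrable_mul_of_memLp_two (hu n).memLp hψ)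
      (integrable_mul_of_memLp_two hv.memLp hψ)]
    simp only [sub_mul, hv_def]

/-- Let `e` be a zero-mean function on the torus that oscillates in the single direction `b` along
`x ↦ R x / η`. Testing the gradients against `ψ(x) e(R x / η)` in a direction `h ⊥ b` produces no
derivative of `e`, so the corresponding moment of the two-scale limit of the gradients vanishes in
the direction `h`. -/
theorem ae_moment_eq_zero {R : Matrix (Fin m) (Fin 3) ℝ} {Ω : Set E3} (hΩ : IsOpen Ω)
    {η : ℕ → ℝ} {u : ℕ → E3 → ℝ} {Du : ℕ → E3 → E3} (hu : ∀ n, IsW12 Ω (u n) (Du n))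
    {v : E3 → ℝ} (hv : WeakTwoScale R Ω η u (fun x _ => v x)) {χ : Fin 3 → E3 → Torus m → ℝ}
    (hχ : ∀ i, WeakTwoScale R Ω η (fun n x => Du n x i) (χ i)) {e : C(Torus m, ℝ)}
    (he : ∫ y, e y ∂(torusMeasure m) = 0) {θ : ℝ → ℝ} (hθ : ContDiff ℝ ∞ θ) {b : E3}
    (heθ : ∀ n x, e (fastPoint R (η n) x) = θ ((η n)⁻¹ * inner ℝ x b)) {h : E3}
    (hb : inner ℝ h b = 0) :
    ∀ᵐ x ∂(volume.restrict Ω), ∑ i, h i * ∫ y, χ i x y * e y ∂(torusMeasure m) = 0 := by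
  have hmom : ∀ i, MemLp (fun x => ∫ y, χ i x y * e y ∂(torusMeasure m)) 2
      (volume.restrict Ω) := by
    intro i
    refine memLp_average ?_
    refine MemLp.of_le_mul (c := ‖e‖) (hχ i).memLp_limit ((hχ i).memLp_limit.1.mul
      (e.continuous.comp continuous_snd).aestronglyMeasurable) (Eventually.of_forall fun p => ?_)
    rw [norm_mul, mul_comm]
    exact mul_le_mul_of_nonneg_right (e.norm_coe_le_norm _) (norm_nonneg _)
  have hsum : MemLp (fun x => ∑ i, h i * ∫ y, χ i x y * e y ∂(torusMeasure m)) 2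
      (volume.restrict Ω) := memLp_finsetSum _ fun i _ => (hmom i).const_mul (h i)
  have hloc : LocallyIntegrableOn
      (fun x => ∑ i, h i * ∫ y, χ i x y * e y ∂(torusMeasure m)) Ω volume :=
    locallyIntegrableOn_of_locallyIntegrable_restrict (hsum.locallyIntegrable (by norm_num))
  refine (ae_restrict_iff' hΩ.measurableSet).mpr
    (hΩ.ae_eq_zero_of_integral_contDiff_smul_eq_zero hloc fun ψ k1 k2 k3 => ?_)
  have hψ := memLp_of_test k1 k2 (volume.restrict Ω)
  have hfd := memLp_fderiv_of_test k1 k2 (volume.restrict Ω) h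
  have hL := hv.tendsto_mul hfd e
  simp only [integral_const_mul, he, mul_zero, integral_zero] at hL
  have hRt : Tendsto (fun n => -∑ i, h i * ∫ x in Ω, Du n x i * (ψ x * e (fastPoint R (η n) x)))
      atTop (𝓝 (-∑ i, h i * ∫ x in Ω, ψ x * ∫ y, χ i x y * e y ∂(torusMeasure m))) :=
    (tendsto_finsetSum _ fun i _ => ((hχ i).tendsto_mul hψ e).const_mul (h i)).neg
  -- Integration by parts against `ψ(x) θ(η⁻¹ x·b)` in the direction `h`.
  have hEq : ∀ n, ∫ x in Ω, u n x * (fderiv ℝ ψ x h * e (fastPoint R (η n) x)) =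
      -∑ i, h i * ∫ x in Ω, Du n x i * (ψ x * e (fastPoint R (η n) x)) := by
    intro n
    have hlin : ContDiff ℝ ∞ fun x : E3 => (η n)⁻¹ * inner ℝ x b :=
      contDiff_const.mul (contDiff_id.inner ℝ contDiff_const)
    have hθn : ContDiff ℝ ∞ fun x : E3 => θ ((η n)⁻¹ * inner ℝ x b) := hθ.comp hlin
    have l1 : ContDiff ℝ ∞ fun x => ψ x * θ ((η n)⁻¹ * inner ℝ x b) := k1.mul hθn
    have l2 : HasCompactSupport fun x => ψ x * θ ((η n)⁻¹ * inner ℝ x b) := k2.mul_right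
    have l3 : tsupport (fun x => ψ x * θ ((η n)⁻¹ * inner ℝ x b)) ⊆ Ω :=
      (tsupport_mul_subset_left).trans k3
    have l4 := weakGradient_direction (hu n) l1 l2 l3 h
    have l5 : ∀ x, fderiv ℝ (fun x => ψ x * θ ((η n)⁻¹ * inner ℝ x b)) x h =
        fderiv ℝ ψ x h * e (fastPoint R (η n) x) := by
      intro x
      -- The oscillating factor is constant along the lines of direction `h`, as `h ⊥ b`.
      have hzero : fderiv ℝ (fun x : E3 => θ ((η n)⁻¹ * inner ℝ x b)) x h = 0 := by
        have d1 : HasDerivAt (fun t : ℝ => x + t • h) h 0 := by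
          simpa using ((hasDerivAt_id (0 : ℝ)).smul_const h).const_add x
        have d2 := HasFDerivAt.comp_hasDerivAt (x := (0 : ℝ))
          (l := fun x : E3 => θ ((η n)⁻¹ * inner ℝ x b)) (f := fun t : ℝ => x + t • h)
          ((hθn.differentiable (by simp)) _).hasFDerivAt d1
        have d3 : ((fun x : E3 => θ ((η n)⁻¹ * inner ℝ x b)) ∘ fun t : ℝ => x + t • h) =
            fun _ => θ ((η n)⁻¹ * inner ℝ x b) := by
          funext t
          simp [inner_add_left, inner_smul_left, hb]
        rw [d3] at d2
        have d4 := d2.unique (hasDerivAt_const (0 : ℝ) _)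
        simpa using d4
      rw [fderiv_fun_mul ((k1.differentiable (by simp)) x) ((hθn.differentiable (by simp)) x)]
      simp only [_root_.add_apply, _root_.smul_apply, smul_eq_mul,
        hzero, mul_zero, zero_add, heθ]
      ring
    simp only [l5] at l4
    rw [l4]
    congr 1
    have hint : ∀ i, Integrable (fun x => Du n x i * (ψ x * e (fastPoint R (η n) x)))
        (volume.restrict Ω) := fun i =>
      integrable_mul_of_memLp_two (MemLp.eval_piLp (hu n).memLp_grad i)
        (memLp_eval (memLp_smul_const hψ e) (continuous_fastPoint R (η n)))
    simp only [← integral_const_mul]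
    rw [← integral_finsetSum _ fun i _ => (hint i).const_mul (h i)]
    refine integral_congr_ae (Eventually.of_forall fun x => ?_)
    simp only [PiLp.inner_apply, RCLike.inner_apply, conj_trivial, Finset.sum_mul, heθ]
    exact Finset.sum_congr rfl fun i _ => by ring
  have hlim := tendsto_nhds_unique hL (hRt.congr fun n => (hEq n).symm)
  have hzero := neg_eq_zero.mp hlim.symm
  rw [← hzero]
  have e1 : ∫ x, ψ x • ∑ i, h i * ∫ y, χ i x y * e y ∂(torusMeasure m) =
      ∫ x in Ω, ψ x • ∑ i, h i * ∫ y, χ i x y * e y ∂(torusMeasure m) :=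
    (setIntegral_eq_integral_of_forall_compl_eq_zero fun x hx => by
      rw [image_eq_zero_of_notMem_tsupport fun h => hx (k3 h), zero_smul]).symm
  rw [e1]
  simp only [← integral_const_mul (μ := volume.restrict Ω)]
  rw [← integral_finsetSum _ fun i _ =>
    (integrable_mul_of_memLp_two hψ (hmom i)).const_mul (h i)]
  refine integral_congr_ae (Eventually.of_forall fun x => ?_)
  simp only [smul_eq_mul, Finset.mul_sum]
  exact Finset.sum_congr rfl fun i _ => by ring

/-! ### `R`-gradients and their Fourier coefficients -/

theorem mFourierCoeff_eq_integral_torusMeasure (f : Torus m → ℂ) (k : Fin m → ℤ) :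
    UnitAddTorus.mFourierCoeff f k =
      ∫ y, UnitAddTorus.mFourier (-k) y * f y ∂(torusMeasure m) := rfl

/-- The real part of the character `exp (2πi k·y)`. -/
noncomputable def mFourierRe (k : Fin m → ℤ) : C(Torus m, ℝ) :=
  ⟨fun y => (UnitAddTorus.mFourier k y).re,
    Complex.continuous_re.comp (UnitAddTorus.mFourier k).continuous⟩

/-- The imaginary part of the character `exp (2πi k·y)`. -/
noncomputable def mFourierIm (k : Fin m → ℤ) : C(Torus m, ℝ) :=
  ⟨fun y => (UnitAddTorus.mFourier k y).im,
    Complex.continuous_im.comp (UnitAddTorus.mFourier k).continuous⟩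

theorem integrable_mFourier_mul (k : Fin m → ℤ) {f : Torus m → ℝ}
    (hf : Integrable f (torusMeasure m)) :
    Integrable (fun y => UnitAddTorus.mFourier k y * (f y : ℂ)) (torusMeasure m) :=
  hf.ofReal.bdd_mul (c := 1) (UnitAddTorus.mFourier k).continuous.aestronglyMeasurable
    (Eventually.of_forall fun y => ((UnitAddTorus.mFourier k).norm_coe_le_norm y).trans_eq
      UnitAddTorus.mFourier_norm)

theorem integral_mFourier_mul (k : Fin m → ℤ) {f : Torus m → ℝ}
    (hf : Integrable f (torusMeasure m)) :
    ∫ y, UnitAddTorus.mFourier k y * (f y : ℂ) ∂(torusMeasure m) =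
      ((∫ y, f y * mFourierRe k y ∂(torusMeasure m) : ℝ) : ℂ) +
        ((∫ y, f y * mFourierIm k y ∂(torusMeasure m) : ℝ) : ℂ) * Complex.I := by
  rw [← integral_re_add_im (integrable_mFourier_mul k hf)]
  simp [mFourierRe, mFourierIm, mul_comm]

theorem integral_mFourierRe_im {k : Fin m → ℤ} (hk : k ≠ 0) :
    ∫ y, mFourierRe k y ∂(torusMeasure m) = 0 ∧ ∫ y, mFourierIm k y ∂(torusMeasure m) = 0 := by
  have h := integral_mFourier_mul k (integrable_const (μ := torusMeasure m) (1 : ℝ))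
  simp only [Complex.ofReal_one, mul_one, one_mul, integral_mFourier, if_neg hk] at h
  have h1 := congrArg Complex.re h
  have h2 := congrArg Complex.im h
  constructor
  · simpa using h1.symm
  · simpa using h2.symm

/-- The Fourier coefficients of the two-scale limit of the gradients are parallel to the
frequencies `Rᵀ k`: all `2 × 2` minors vanish. -/
theorem ae_freq_mul_comm {R : Matrix (Fin m) (Fin 3) ℝ} {Ω : Set E3} (hΩ : IsOpen Ω)
    {η : ℕ → ℝ} {u : ℕ → E3 → ℝ} {Du : ℕ → E3 → E3} (hu : ∀ n, IsW12 Ω (u n) (Du n))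
    {v : E3 → ℝ} (hv : WeakTwoScale R Ω η u (fun x _ => v x)) {χ : Fin 3 → E3 → Torus m → ℝ}
    (hχ : ∀ i, WeakTwoScale R Ω η (fun n x => Du n x i) (χ i)) {k : Fin m → ℤ} (hk : k ≠ 0)
    (i j : Fin 3) :
    ∀ᵐ x ∂(volume.restrict Ω),
      (freq R k i : ℂ) * ∫ y, UnitAddTorus.mFourier k y * (χ j x y : ℂ) ∂(torusMeasure m) =
        (freq R k j : ℂ) *
          ∫ y, UnitAddTorus.mFourier k y * (χ i x y : ℂ) ∂(torusMeasure m) := by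
  set b := freq R k with hb
  set h : E3 := b i • EuclideanSpace.single j 1 - b j • EuclideanSpace.single i 1 with hh
  have hperp : inner ℝ h b = 0 := by
    rw [hh, inner_sub_left, inner_smul_left, inner_smul_left, EuclideanSpace.inner_single_left,
      EuclideanSpace.inner_single_left]
    simp [mul_comm]
  have hsum : ∀ M : Fin 3 → ℝ, ∑ l, h l * M l = b i * M j - b j * M i := by
    intro M
    simp only [hh, PiLp.sub_apply, PiLp.smul_apply, PiLp.single_apply, smul_eq_mul, mul_ite,
      mul_one, mul_zero, sub_mul, ite_mul, zero_mul, Finset.sum_sub_distrib]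
    simp
  obtain ⟨z1, z2⟩ := integral_mFourierRe_im hk
  have h1 := ae_moment_eq_zero hΩ hu hv hχ z1 (θ := fun t => Real.cos (2 * Real.pi * t))
    (by fun_prop) (b := b) (fun n x => by
      change (UnitAddTorus.mFourier k _).re = _
      rw [mFourier_fastPoint, Complex.exp_ofReal_mul_I_re]) hperp
  have h2 := ae_moment_eq_zero hΩ hu hv hχ z2 (θ := fun t => Real.sin (2 * Real.pi * t))
    (by fun_prop) (b := b) (fun n x => by
      change (UnitAddTorus.mFourier k _).im = _
      rw [mFourier_fastPoint, Complex.exp_ofReal_mul_I_im]) hperp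
  filter_upwards [h1, h2, ae_memLp_section (hχ i).memLp_limit,
    ae_memLp_section (hχ j).memLp_limit] with x e1 e2 hi hj
  rw [hsum, sub_eq_zero] at e1 e2
  rw [integral_mFourier_mul k (hi.integrable (by norm_num)),
    integral_mFourier_mul k (hj.integrable (by norm_num)), mul_add, mul_add, ← mul_assoc,
    ← mul_assoc, ← Complex.ofReal_mul, ← Complex.ofReal_mul, ← Complex.ofReal_mul,
    ← Complex.ofReal_mul, e1, e2]

/-- The potential whose `R`-gradient is the orthogonal projection of the field `f` on the
`R`-gradients: mode by mode, the component of the Fourier coefficient of `f` along `Rᵀ k` is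
divided by the symbol. At `k = 0` the convention `0 / 0 = 0` gives the coefficient zero. -/
noncomputable def gradPotential (R : Matrix (Fin m) (Fin 3) ℝ) (f : Fin 3 → Torus m → ℝ) :
    Potential m where
  coeff k := (∑ i, (freq R k i : ℂ) * UnitAddTorus.mFourierCoeff (fun y => (f i y : ℂ)) k) /
    (2 * Real.pi * Complex.I * ((‖freq R k‖ ^ 2 : ℝ) : ℂ))
  coeff_neg k := by
    have h2 : ∀ i, UnitAddTorus.mFourierCoeff (fun y => (f i y : ℂ)) (-k) =
        starRingEnd ℂ (UnitAddTorus.mFourierCoeff (fun y => (f i y : ℂ)) k) := by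
      intro i
      rw [mFourierCoeff_eq_integral_torusMeasure, mFourierCoeff_eq_integral_torusMeasure,
        ← integral_conj]
      simp only [map_mul, UnitAddTorus.mFourier_neg, Complex.conj_ofReal,
        RingHomCompTriple.comp_apply, RingHom.id_apply]
    simp only [freq_neg, h2, norm_neg, map_div₀, map_sum, map_mul, Complex.conj_ofReal,
      Complex.conj_I, PiLp.neg_apply, Complex.ofReal_neg, neg_mul, Finset.sum_neg_distrib,
      map_ofNat, mul_neg,
      div_neg, neg_div]

/-- A field on the torus whose nonzero Fourier modes are parallel to the frequencies `Rᵀ k` is an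
`R`-gradient up to its mean. -/
theorem isGradR_gradPotential {R : Matrix (Fin m) (Fin 3) ℝ} (hR : IsIrrational R)
    {f : Fin 3 → Torus m → ℝ} (hf : ∀ i, MemLp (f i) 2 (torusMeasure m))
    (hpar : ∀ k : Fin m → ℤ, k ≠ 0 → ∀ i j,
      (freq R k i : ℂ) * UnitAddTorus.mFourierCoeff (fun y => (f j y : ℂ)) k =
        (freq R k j : ℂ) * UnitAddTorus.mFourierCoeff (fun y => (f i y : ℂ)) k) :
    IsGradR R (gradPotential R f)
      (fun y => WithLp.toLp 2 fun i => f i y - ∫ z, f i z ∂(torusMeasure m)) where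
  memLp := MemLp.of_eval_piLp fun i => (hf i).sub (memLp_const _)
  fourier := by
    intro k i
    have hi : Integrable (f i) (torusMeasure m) := (hf i).integrable (by norm_num)
    have e1 : UnitAddTorus.mFourierCoeff
        (fun y => ((f i y - ∫ z, f i z ∂(torusMeasure m) : ℝ) : ℂ)) k =
        UnitAddTorus.mFourierCoeff (fun y => (f i y : ℂ)) k -
          (if -k = 0 then 1 else 0) * ((∫ z, f i z ∂(torusMeasure m) : ℝ) : ℂ) := by
      rw [mFourierCoeff_eq_integral_torusMeasure, mFourierCoeff_eq_integral_torusMeasure,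
        ← integral_mFourier, ← integral_mul_const, ← integral_sub (integrable_mFourier_mul _ hi)
          (integrable_mFourier_mul _ (integrable_const _))]
      simp only [Complex.ofReal_sub, mul_sub]
    refine e1.trans ?_
    change _ = 2 * Real.pi * Complex.I * ((freq R k i : ℝ) : ℂ) * (gradPotential R f).coeff k
    by_cases hk : k = 0
    · subst hk
      rw [freq_zero, mFourierCoeff_eq_integral_torusMeasure]
      simp [UnitAddTorus.mFourier_zero, integral_complex_ofReal]
    · have hb : freq R k ≠ 0 := freq_ne_zero hR hk
      have hb' : ((‖freq R k‖ ^ 2 : ℝ) : ℂ) ≠ 0 :=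
        Complex.ofReal_ne_zero.mpr (pow_ne_zero 2 (norm_ne_zero_iff.mpr hb))
      have hpi : (2 * Real.pi * Complex.I : ℂ) ≠ 0 := Complex.two_pi_I_ne_zero
      rw [if_neg (neg_ne_zero.mpr hk), zero_mul, sub_zero]
      have key : (freq R k i : ℂ) * ∑ j, (freq R k j : ℂ) *
          UnitAddTorus.mFourierCoeff (fun y => (f j y : ℂ)) k =
          ((‖freq R k‖ ^ 2 : ℝ) : ℂ) * UnitAddTorus.mFourierCoeff (fun y => (f i y : ℂ)) k := by
        rw [EuclideanSpace.norm_sq_eq, Finset.mul_sum, Complex.ofReal_sum, Finset.sum_mul]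
        refine Finset.sum_congr rfl fun j _ => ?_
        rw [mul_left_comm, hpar k hk i j, Real.norm_eq_abs, sq_abs]
        push_cast
        ring
      change _ = 2 * Real.pi * Complex.I * ((freq R k i : ℝ) : ℂ) * (_ / _)
      rw [eq_comm, mul_assoc, mul_div_assoc', key, mul_div_assoc', div_eq_iff
        (mul_ne_zero hpi hb')]
      ring

theorem aestronglyMeasurable_mFourierCoeff {μ : Measure E3} [SFinite μ] {F : E3 → Torus m → ℝ}
    (hF : AEStronglyMeasurable (fun p : E3 × Torus m => F p.1 p.2) (μ.prod (torusMeasure m)))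
    (k : Fin m → ℤ) :
    AEStronglyMeasurable (fun x => UnitAddTorus.mFourierCoeff (fun y => (F x y : ℂ)) k) μ := by
  have h : AEStronglyMeasurable (fun p : E3 × Torus m =>
      UnitAddTorus.mFourier (-k) p.2 * (F p.1 p.2 : ℂ)) (μ.prod (torusMeasure m)) :=
    ((UnitAddTorus.mFourier (-k)).continuous.comp continuous_snd).aestronglyMeasurable.mul
      (Complex.continuous_ofReal.comp_aestronglyMeasurable hF)
  exact h.integral_prod_right'

/-! ### Extraction of the subsequence and conclusion -/

theorem exists_weakTwoScale_subseq_finset {R : Matrix (Fin m) (Fin 3) ℝ} (hR : IsIrrational R)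
    {Ω : Set E3} (hΩfin : volume Ω < ⊤)
    {η : ℕ → ℝ} (hη_pos : ∀ n, 0 < η n) (hη : Tendsto η atTop (𝓝 0)) {ι : Type*}
    {u : ι → ℕ → E3 → ℝ} (hu : ∀ i n, MemLp (u i n) 2 (volume.restrict Ω)) {C : ℝ≥0}
    (hC : ∀ i n, eLpNorm (u i n) 2 (volume.restrict Ω) ≤ C) (S : Finset ι) :
    ∃ σ : ℕ → ℕ, StrictMono σ ∧ ∀ i ∈ S, ∃ u₀ : E3 → Torus m → ℝ,
      WeakTwoScale R Ω (fun k => η (σ k)) (fun k => u i (σ k)) u₀ := by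
  classical
  induction S using Finset.induction_on with
  | empty => exact ⟨id, strictMono_id, by simp⟩
  | insert a S _ ih =>
    obtain ⟨σ, hσ, h⟩ := ih
    obtain ⟨τ, hτ, u₀, h₀⟩ := exists_weakTwoScale_subseq hR hΩfin (fun k => hη_pos (σ k))
      (hη.comp hσ.tendsto_atTop) (fun k => hu a (σ k)) (fun k => hC a (σ k))
    refine ⟨fun k => σ (τ k), hσ.comp hτ, fun i hi => ?_⟩
    rcases Finset.mem_insert.mp hi with rfl | hi
    · exact ⟨u₀, h₀⟩
    · obtain ⟨w, hw⟩ := h i hi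
      exact ⟨w, hw.comp hτ⟩

theorem eLpNorm_le_w12Norm (Ω : Set E3) (u : E3 → ℝ) (g : E3 → E3) :
    eLpNorm u 2 (volume.restrict Ω) ≤ w12Norm Ω u g ∧
      eLpNorm g 2 (volume.restrict Ω) ≤ w12Norm Ω u g := by
  have h : ∀ a : ℝ≥0∞, (a ^ 2) ^ (1 / 2 : ℝ) = a := fun a => by
    rw [← ENNReal.rpow_natCast, ← ENNReal.rpow_mul]
    norm_num
  constructor
  · conv_lhs => rw [← h (eLpNorm u 2 (volume.restrict Ω))]
    exact ENNReal.rpow_le_rpow le_self_add (by norm_num)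
  · conv_lhs => rw [← h (eLpNorm g 2 (volume.restrict Ω))]
    exact ENNReal.rpow_le_rpow le_add_self (by norm_num)

end CutProjection

theorem mainTheorem5 {m : ℕ} (hm : 3 < m) (R : Matrix (Fin m) (Fin 3) ℝ)
    (hR : CutProjection.IsIrrational R)
    (Ω : Set CutProjection.E3) (hΩ_open : IsOpen Ω) (hΩ_bdd : Bornology.IsBounded Ω)
    (hΩ_lip : CutProjection.HasLipschitzBoundary Ω)
    (η : ℕ → ℝ) (hη_pos : ∀ n, 0 < η n) (hη : Tendsto η atTop (𝓝 0))
    (u : ℕ → CutProjection.E3 → ℝ) (Du : ℕ → CutProjection.E3 → CutProjection.E3)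
    (hu : ∀ n, CutProjection.IsW12 Ω (u n) (Du n))
    (hu_bdd : ∃ C : ℝ≥0, ∀ n, CutProjection.w12Norm Ω (u n) (Du n) ≤ C) :
    ∃ σ : ℕ → ℕ, StrictMono σ ∧
      ∃ (v : CutProjection.E3 → ℝ) (Dv : CutProjection.E3 → CutProjection.E3)
        (u₁ : CutProjection.E3 → CutProjection.Potential m)
        (w : CutProjection.E3 → CutProjection.Torus m → CutProjection.E3),
        CutProjection.IsW12 Ω v Dv ∧
        (∀ k : Fin m → ℤ,
          AEStronglyMeasurable (fun x => (u₁ x).coeff k) (volume.restrict Ω)) ∧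
        MemLp (fun p : CutProjection.E3 × CutProjection.Torus m => w p.1 p.2) 2
          ((volume.restrict Ω).prod (CutProjection.torusMeasure m)) ∧
        (∀ᵐ x ∂(volume.restrict Ω), CutProjection.IsGradR R (u₁ x) (w x)) ∧
        CutProjection.StrongTwoScale R Ω (fun k => η (σ k)) (fun k => u (σ k))
          (fun x _ => v x) ∧
        CutProjection.WeakTwoScaleVec R Ω (fun k => η (σ k)) (fun k => Du (σ k))
          (fun x y => Dv x + w x y) := by
  open CutProjection in
  obtain ⟨C, hC⟩ := hu_bdd
  have hΩfin : volume Ω < ⊤ := hΩ_bdd.measure_lt_top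
  have huC : ∀ n, eLpNorm (u n) 2 (volume.restrict Ω) ≤ C := fun n =>
    (eLpNorm_le_w12Norm Ω (u n) (Du n)).1.trans (hC n)
  have hDuC : ∀ n, eLpNorm (Du n) 2 (volume.restrict Ω) ≤ C := fun n =>
    (eLpNorm_le_w12Norm Ω (u n) (Du n)).2.trans (hC n)
  obtain ⟨τ, hτ, u₀, hu₀⟩ := exists_weakTwoScale_subseq hR hΩfin hη_pos hη
    (fun n => (hu n).memLp) huC
  obtain ⟨ρ, hρ, hgrad⟩ := exists_weakTwoScale_subseq_finset hR hΩfin (fun k => hη_pos (τ k))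
    (hη.comp hτ.tendsto_atTop) (u := fun (i : Fin 3) n x => Du (τ n) x i)
    (fun i n => (hu (τ n)).memLp_grad.eval_piLp i)
    (fun i n => (eLpNorm_mono fun x => PiLp.norm_apply_le _ i).trans (hDuC (τ n))) Finset.univ
  choose χ hχ using fun i => hgrad i (Finset.mem_univ i)
  set σ : ℕ → ℕ := fun k => τ (ρ k) with hσ_def
  have hσ : StrictMono σ := hτ.comp hρ
  have hησ : Tendsto (fun k => η (σ k)) atTop (𝓝 0) := hη.comp hσ.tendsto_atTop
  have h₀ : WeakTwoScale R Ω (fun k => η (σ k)) (fun k => u (σ k)) u₀ := hu₀.comp hρ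
  have huσ : ∀ n, IsW12 Ω (u (σ n)) (Du (σ n)) := fun n => hu (σ n)
  have hW12 := isW12_average huσ h₀ hχ
  have hstrong := strongTwoScale_average hR hΩ_open hΩ_bdd hΩ_lip (fun k => hη_pos (σ k)) hησ
    huσ (fun n => ENNReal.toReal_le_coe_of_le_coe (huC (σ n)))
    (fun n => ENNReal.toReal_le_coe_of_le_coe (hDuC (σ n))) h₀ hχ
  refine ⟨σ, hσ, _, _, fun x => gradPotential R fun i => χ i x,
    fun x y => WithLp.toLp 2 fun i => χ i x y - ∫ z, χ i x z ∂(torusMeasure m),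
    hW12, fun k => ?_, ?_, ?_, hstrong, fun i => ?_⟩
  · simp only [gradPotential, div_eq_mul_inv]
    refine AEStronglyMeasurable.mul_const ?_ _
    exact Finset.aestronglyMeasurable_fun_sum _ fun i _ =>
      (aestronglyMeasurable_mFourierCoeff (hχ i).memLp_limit.1 k).const_mul _
  · exact MemLp.of_eval_piLp fun i => (hχ i).memLp_limit.sub
      ((memLp_average (hχ i).memLp_limit).comp_fst (torusMeasure m))
  · have hpar : ∀ᵐ x ∂(volume.restrict Ω), ∀ k : Fin m → ℤ, k ≠ 0 → ∀ i j,
        (freq R (-k) i : ℂ) * UnitAddTorus.mFourierCoeff (fun y => (χ j x y : ℂ)) k =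
        (freq R (-k) j : ℂ) * UnitAddTorus.mFourierCoeff (fun y => (χ i x y : ℂ)) k := by
      simp only [ae_all_iff]
      exact fun k hk i j =>
        ae_freq_mul_comm hΩ_open huσ hstrong.weak hχ (neg_ne_zero.mpr hk) i j
    filter_upwards [hpar, ae_all_iff.mpr fun i => ae_memLp_section (hχ i).memLp_limit]
      with x h1 h2
    refine isGradR_gradPotential hR h2 fun k hk i j => ?_
    have h3 := h1 k hk i j
    simpa [freq_neg] using h3
  · convert! hχ i using 3
    simp
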